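/- Let $M$ be a finite matroid of rank $r$ on the ground set $S$, and assume that $M$ is a split matroid in the sense of Joswig and Schröter: with $P(M)=\operatorname{conv}\{\chi_B : B \text{ a basis of } M\}\subseteq\mathbb{R}^S$ the base polytope and $\Delta=\{x\in[0,1]^S:\sum_{s\in S}x_s=r\}$ the hypersimplex, the affine hulls of any two distinct facets of $P(M)$ have no common point in the relative interior of $\Delta\cap\operatorname{aff}P(M)$. For an ordered pair $(X_1,X_2)$ of bases of $M$ and elements $e\in X_1\setminus X_2$, $f\in X_2\setminus X_1$ such that both $(X_1\setminus\{e\})\cup\{f\}$ and $(X_2\setminus\{f\})\cup\{e\}$ are bases, the pair formed by these two bases is said to be obtained from $(X_1,X_2)$ by a symmetric exchange. Two ordered pairs $(X_1,X_2)$ and $(Y_1,Y_2)$ of bases are called compatible if $|\{i\in\{1,2\}: s\in X_i\}|=|\{i\in\{1,2\}: s\in Y_i\}|$ for every $s\in S$ (equivalently, $X_1\cap X_2=Y_1\cap Y_2$ and $X_1\cup X_2=Y_1\cup Y_2$). Then White's conjecture holds for basis sequences of length two in $M$: for any two ordered pairs $(X_1,X_2)$ and $(Y_1,Y_2)$ of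 bases of $M$, the pair $(Y_1,Y_2)$ can be obtained from $(X_1,X_2)$ by a finite (possibly empty) sequence of symmetric exchanges if and only if the two pairs are compatible. -/

import Mathlib

open Set

/-! Basis sequences of a matroid and White's equivalence. -/

/-- `X'` arises from the sequence `X` of sets by one symmetric exchange in the matroid `M`: for some
positions `i < j` and some `e ∈ X i - X j`, `f ∈ X j - X i` such that `X i - e + f` and
`X j + e - f` are bases, these two sets replace `X i` and `X j`. -/
def SymmExchange {α : Type*} (M : Matroid α) {m : ℕ} (X X' : Fin m → Set α) : Prop :=
  ∃ i j : Fin m, i < j ∧ ∃ e ∈ X i \ X j, ∃ f ∈ X j \ X i,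
    M.IsBase (insert f (X i \ {e})) ∧ M.IsBase (insert e (X j \ {f})) ∧
    X' = Function.update (Function.update X i (insert f (X i \ {e}))) j (insert e (X j \ {f}))

/-- `Y` is obtained from `X` by a (possibly empty) finite composition of symmetric exchanges. -/
def SeqEquivalent {α : Type*} (M : Matroid α) {m : ℕ} (X Y : Fin m → Set α) : Prop :=
  Relation.ReflTransGen (SymmExchange M) X Y

/-- Every element of the ground set lies in as many members of `X` as of `Y`. -/
def SeqCompatible {α : Type*} (M : Matroid α) {m : ℕ} (X Y : Fin m → Set α) : Prop :=
  ∀ s ∈ M.E, {i | s ∈ X i}.ncard = {i | s ∈ Y i}.ncard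

/-! Split matroids, defined polyhedrally.  All polytopes live in `α → ℝ`; the coordinates outside the
ground set are zero. -/

/-- The matroid base polytope: the convex hull of the indicator vectors of the bases. -/
noncomputable def basePolytope {α : Type*} (M : Matroid α) : Set (α → ℝ) :=
  convexHull ℝ {x | ∃ B, M.IsBase B ∧ x = B.indicator 1}

/-- The hypersimplex of order `r` on the (finite) set `E`, i.e. the base polytope of the uniform
matroid of rank `r` on `E`, in its description by inequalities. -/
def hypersimplex {α : Type*} (E : Set α) (r : ℕ) : Set (α → ℝ) :=
  {x | (∀ i, 0 ≤ x i ∧ x i ≤ 1) ∧ (∀ i ∉ E, x i = 0) ∧ ∑ᶠ i ∈ E, x i = r}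

/-- `Φ` is a facet of the polytope `P`: a nonempty (exposed) face of dimension `dim P - 1`. -/
def IsFacet {α : Type*} (P Φ : Set (α → ℝ)) : Prop :=
  Φ.Nonempty ∧ IsExposed ℝ P Φ ∧
    Module.finrank ℝ (vectorSpan ℝ Φ) + 1 = Module.finrank ℝ (vectorSpan ℝ P)

/-- The part of the hypersimplex (with the ground set and the rank of `M`) in the affine hull of the
base polytope of `M`.  If `M` is connected, then it is the hypersimplex itself. -/
noncomputable def ambientPolytope {α : Type*} (M : Matroid α) : Set (α → ℝ) :=
  hypersimplex M.E M.eRank.toNat ∩ affineSpan ℝ (basePolytope M)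

/-- A matroid is split if the hyperplanes (in the affine hull of its base polytope) spanned by the
facets of its base polytope are compatible: no two of them meet in the relative interior of the
ambient polytope.  The facets that are cut out by facets of the hypersimplex impose no condition,
since their hyperplanes miss this relative interior; the others are those along which parts of the
hypersimplex are split off to obtain the base polytope. -/
def IsSplit {α : Type*} (M : Matroid α) : Prop :=
  ∀ Φ Ψ : Set (α → ℝ), IsFacet (basePolytope M) Φ → IsFacet (basePolytope M) Ψ → Φ ≠ Ψ →
    Disjoint ((affineSpan ℝ Φ : Set (α → ℝ)) ∩ affineSpan ℝ Ψ)
      (intrinsicInterior ℝ (ambientPolytope M))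

/-! Exchanges preserve multiplicities, so only the converse needs work. The distance from a pair
`(A, A')` to a compatible target `(B, B')` is `|A \ B|`; it suffices to lower it by finitely many
exchanges, working inside one connected component `C` of the matroid, which all bases meet in the
same number `k` of elements.

Polyhedral input. If `A - e + f` is not a base, with `e`, `f` in `C`, the fundamental circuit of `f`
gives a valid inequality `x(L) ≤ ρ(L)`, tight at `A`, with `f ∈ L` and `e ∉ L`. Rotating its
hyperplane turns it into a facet (`IsBase.exists_isFacetSet`). Splitness yields `|L ∩ L'| + k ≤ ρ(L)
+ ρ(L')` for distinct facet sets of `C` (`IsFacetSet.card_inter_add_le`): otherwise the two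
hyperplanes meet at a relatively interior point of the ambient polytope. `SplitSystem` records
exactly these facts, and the rest is combinatorial.

Combinatorics. By the intersection bound, a set tight at `A` is determined by one element of `C \ A`
inside it, or by one element of `A ∩ C` outside it. If no single exchange lowers the distance, two
sets `H₁, H₂` tight at `A` and two sets `H₃, H₄` tight at `A'` account for all failures. Double
counting produces an element `z` in both sets of one pair and in neither of the other
(`exists_mem_of_cyclic`), and a detour through `z` consisting of two exchanges lowers the distance
(`double_exchange`). -/

/-- One symmetric exchange between two finite sets satisfying `IsB`. -/
def PairExchange {α : Type*} [DecidableEq α] (IsB : Finset α → Prop)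
    (p q : Finset α × Finset α) : Prop :=
  ∃ e ∈ p.1 \ p.2, ∃ f ∈ p.2 \ p.1,
    IsB (insert f (p.1.erase e)) ∧ IsB (insert e (p.2.erase f)) ∧
    q = (insert f (p.1.erase e), insert e (p.2.erase f))

/-- A family `𝓛` of subsets of `C` with capacities `ρ` which, inside `C`, cuts out the bases `IsB`
and whose members satisfy the intersection bound of an elementary split matroid. -/
structure SplitSystem {α : Type*} [DecidableEq α] (IsB : Finset α → Prop) (C : Finset α) (k : ℕ)
    (𝓛 : Finset α → Prop) (ρ : Finset α → ℕ) : Prop where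
  card_inter : ∀ {A}, IsB A → (A ∩ C).card = k
  subset : ∀ {L}, 𝓛 L → L ⊆ C
  le : ∀ {A L}, IsB A → 𝓛 L → (A ∩ L).card ≤ ρ L
  exists_tight : ∀ {A e f}, IsB A → e ∈ A → e ∈ C → f ∈ C → f ∉ A →
    ¬ IsB (insert f (A.erase e)) → ∃ L, 𝓛 L ∧ (A ∩ L).card = ρ L ∧ e ∉ L ∧ f ∈ L
  inter_le : ∀ {L L'}, 𝓛 L → 𝓛 L' → L ≠ L' → (L ∩ L').card + k ≤ ρ L + ρ L'

/-! ### Tight sets at a base, and the detour -/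

namespace SplitSystem

variable {α : Type*} [DecidableEq α] {IsB : Finset α → Prop} {C : Finset α} {k : ℕ}
  {𝓛 : Finset α → Prop} {ρ : Finset α → ℕ}

theorem card_inter_add (A L L' : Finset α) :
    (A ∩ L).card + (A ∩ L').card = (A ∩ (L ∪ L')).card + (A ∩ (L ∩ L')).card := by
  rw [← Finset.card_union_add_card_inter, ← Finset.inter_union_distrib_left,
    ← Finset.inter_inter_distrib_left]

/-- Two distinct sets that are tight at a base meet inside it and cover it. -/
theorem tight_pair (h : SplitSystem IsB C k 𝓛 ρ) {A L L' : Finset α} (hA : IsB A) (hL : 𝓛 L)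
    (hL' : 𝓛 L') (hne : L ≠ L') (ht : (A ∩ L).card = ρ L) (ht' : (A ∩ L').card = ρ L') :
    L ∩ L' ⊆ A ∧ A ∩ C ⊆ L ∪ L' := by
  have h1 := card_inter_add A L L'
  have h2 := h.inter_le hL hL' hne
  have h3 := h.card_inter hA
  have s1 : A ∩ (L ∪ L') ⊆ A ∩ C :=
    Finset.inter_subset_inter_left (Finset.union_subset (h.subset hL) (h.subset hL'))
  have s2 : A ∩ (L ∩ L') ⊆ L ∩ L' := Finset.inter_subset_right
  have c1 := Finset.card_le_card s1
  have c2 := Finset.card_le_card s2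
  have e1 := Finset.eq_of_subset_of_card_le s1 (by omega)
  have e2 := Finset.eq_of_subset_of_card_le s2 (by omega)
  constructor
  · rw [← e2]; exact Finset.inter_subset_left
  · rw [← e1]; exact Finset.inter_subset_right

/-- Two distinct tight sets can share only elements of `A`, and together they cover `A ∩ C`. So a
tight set is determined by a single element of it off `A`, or (next lemma) by a single element of `A
∩ C` that it misses. -/
theorem tight_eq_of_mem (h : SplitSystem IsB C k 𝓛 ρ) {A L L' : Finset α} (hA : IsB A) (hL : 𝓛 L)
    (hL' : 𝓛 L') (ht : (A ∩ L).card = ρ L) (ht' : (A ∩ L').card = ρ L') {f : α} (hf : f ∉ A)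
    (h1 : f ∈ L) (h2 : f ∈ L') : L = L' := by
  by_contra hne
  exact hf ((h.tight_pair hA hL hL' hne ht ht').1 (Finset.mem_inter.2 ⟨h1, h2⟩))

theorem tight_eq_of_notMem (h : SplitSystem IsB C k 𝓛 ρ) {A L L' : Finset α} (hA : IsB A)
    (hL : 𝓛 L) (hL' : 𝓛 L') (ht : (A ∩ L).card = ρ L) (ht' : (A ∩ L').card = ρ L') {e : α}
    (he : e ∈ A) (heC : e ∈ C) (h1 : e ∉ L) (h2 : e ∉ L') : L = L' := by
  by_contra hne
  have := (h.tight_pair hA hL hL' hne ht ht').2 (Finset.mem_inter.2 ⟨he, heC⟩)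
  simp_all

theorem card_swap_inter {A L : Finset α} {e f : α} (he : e ∈ A) (hf : f ∉ A) :
    (insert f (A.erase e) ∩ L).card + (if e ∈ L then 1 else 0)
      = (A ∩ L).card + (if f ∈ L then 1 else 0) := by
  have key : ∀ S : Finset α, (S ∩ L).card = ∑ x ∈ S, if x ∈ L then 1 else 0 := by
    intro S; rw [← Finset.filter_mem_eq_inter, Finset.card_filter]
  rw [key, key, Finset.sum_insert (by simp [hf]), ← Finset.add_sum_erase A _ he]
  ring

/-- The detour: an exchange of `z` and `f` followed by one of `e` and `g`. -/
theorem double_exchange (h : SplitSystem IsB C k 𝓛 ρ) {A A' : Finset α} (hA : IsB A)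
    (hA' : IsB A') {H₁ H₂ H₄ : Finset α} (h₁ : 𝓛 H₁) (h₂ : 𝓛 H₂) (h₄ : 𝓛 H₄)
    (t₁ : (A ∩ H₁).card = ρ H₁) (t₂ : (A ∩ H₂).card = ρ H₂) (t₄ : (A' ∩ H₄).card = ρ H₄)
    {z e f g : α} (hz : z ∈ A \ A') (he : e ∈ A \ A') (hf : f ∈ A' \ A) (hg : g ∈ A' \ A)
    (hz1 : z ∈ H₁) (hz2 : z ∈ H₂) (hz4 : z ∉ H₄) (hf1 : f ∈ H₁) (hf2 : f ∉ H₂) (hf4 : f ∉ H₄)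
    (he1 : e ∈ H₁) (he2 : e ∉ H₂) (he4 : e ∈ H₄) (hg1 : g ∉ H₁) (hg2 : g ∈ H₂) (hg4 : g ∈ H₄) :
    ∃ q, Relation.ReflTransGen (PairExchange IsB) (A, A') q ∧ q.1 ⊆ insert f (insert g (A.erase e)) := by
  have hzA := (Finset.mem_sdiff.1 hz).1
  have hzA' := (Finset.mem_sdiff.1 hz).2
  have heA := (Finset.mem_sdiff.1 he).1
  have heA' := (Finset.mem_sdiff.1 he).2
  have hfA' := (Finset.mem_sdiff.1 hf).1
  have hfA := (Finset.mem_sdiff.1 hf).2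
  have hgA' := (Finset.mem_sdiff.1 hg).1
  have hgA := (Finset.mem_sdiff.1 hg).2
  have hC : ∀ x ∈ H₁, x ∈ C := fun x hx => h.subset h₁ hx
  have hgC : g ∈ C := h.subset h₂ hg2
  have hez : e ≠ z := by rintro rfl; exact he2 hz2
  have hgf : g ≠ f := by rintro rfl; exact hg1 hf1
  have hfe : f ≠ e := by rintro rfl; exact hfA heA
  have hgz : g ≠ z := by rintro rfl; exact hgA hzA
  have hge : g ≠ e := by rintro rfl; exact hgA heA
  set A₁ := insert f (A.erase z) with hA₁
  set A₁' := insert z (A'.erase f) with hA₁'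
  -- An obstruction would be tight at `A` and contain `f`, hence equal `H₁`, but `H₁` contains `z`.
  -- Dually, at `A'` the only tight set missing `f` is `H₄`, which does not contain `z`.
  have b1 : IsB A₁ := by
    by_contra hn
    obtain ⟨L, hL, tL, hzL, hfL⟩ := h.exists_tight hA hzA (hC z hz1) (hC f hf1) hfA hn
    rw [h.tight_eq_of_mem hA hL h₁ tL t₁ hfA hfL hf1] at hzL
    exact hzL hz1
  have b1' : IsB A₁' := by
    by_contra hn
    obtain ⟨L, hL, tL, hfL, hzL⟩ := h.exists_tight hA' hfA' (hC f hf1) (hC z hz1) hzA' hn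
    rw [h.tight_eq_of_notMem hA' hL h₄ tL t₄ hfA' (hC f hf1) hfL hf4] at hzL
    exact hz4 hzL
  have heA1 : e ∈ A₁ := by simp [hA₁, hez, heA]
  have heA1' : e ∉ A₁' := by simp [hA₁', hez, heA']
  have hgA1' : g ∈ A₁' := by simp [hA₁', hgf, hgA']
  have hgA1 : g ∉ A₁ := by simp [hA₁, hgf, hgA]
  -- The first exchange left `H₂` exactly one short of tight, so an obstruction `L` differs from
  -- `H₂`. As `e` lies outside `L ∪ H₂` and `g` in `(L ∩ H₂) \ A₁`, two units are lost in the count,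
  -- one more than the slack of `H₂` allows.
  have b2 : IsB (insert g (A₁.erase e)) := by
    by_contra hn
    obtain ⟨L, hL, tL, heL, hgL⟩ := h.exists_tight b1 heA1 (hC e he1) hgC hgA1 hn
    have t2 := card_swap_inter (L := H₂) hzA hfA
    rw [← hA₁] at t2
    simp only [hz2, hf2, if_true, if_false] at t2
    have hne : L ≠ H₂ := by rintro rfl; omega
    have c1 := card_inter_add A₁ L H₂
    have c2 := h.inter_le hL h₂ hne
    have c3 := h.card_inter b1
    have c4 : (A₁ ∩ (L ∪ H₂)).card < (A₁ ∩ C).card := by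
      apply Finset.card_lt_card
      refine ⟨Finset.inter_subset_inter_left (Finset.union_subset (h.subset hL) (h.subset h₂)), ?_⟩
      intro hs
      have := hs (Finset.mem_inter.2 ⟨heA1, hC e he1⟩)
      simp [heL, he2] at this
    have c5 : (A₁ ∩ (L ∩ H₂)).card < (L ∩ H₂).card := by
      apply Finset.card_lt_card
      refine ⟨Finset.inter_subset_right, ?_⟩
      intro hs
      have := hs (Finset.mem_inter.2 ⟨hgL, hg2⟩)
      simp [hgA1] at this
    omega
  -- `H₄` contains neither `z` nor `f`, so it is still tight.
  have b2' : IsB (insert e (A₁'.erase g)) := by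
    by_contra hn
    obtain ⟨L, hL, tL, hgL, heL⟩ := h.exists_tight b1' hgA1' hgC (hC e he1) heA1' hn
    have t4 := card_swap_inter (L := H₄) hfA' hzA'
    rw [← hA₁'] at t4
    simp only [hz4, hf4, if_false, add_zero] at t4
    have := h.tight_eq_of_mem b1' hL h₄ tL (t4.trans t₄) heA1' heL he4
    exact hgL (this ▸ hg4)
  refine ⟨(insert g (A₁.erase e), insert e (A₁'.erase g)), ?_, ?_⟩
  · exact (Relation.ReflTransGen.single ⟨z, hz, f, hf, b1, b1', rfl⟩).tail
      ⟨e, Finset.mem_sdiff.2 ⟨heA1, heA1'⟩, g, Finset.mem_sdiff.2 ⟨hgA1', hgA1⟩, b2, b2', rfl⟩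
  · intro x hx
    simp only [hA₁, Finset.mem_insert, Finset.mem_erase] at hx ⊢
    tauto

/-- Four sets tight at the two members of a basis pair in the position in which no exchange brings
the pair closer to its target leave room for a detour. -/
theorem exists_mem_of_cyclic (h : SplitSystem IsB C k 𝓛 ρ) {A A' : Finset α} (hA : IsB A)
    (hA' : IsB A') {H₁ H₂ H₃ H₄ : Finset α} (h₁ : 𝓛 H₁) (h₂ : 𝓛 H₂) (h₃ : 𝓛 H₃) (h₄ : 𝓛 H₄)
    (n12 : H₁ ≠ H₂) (n34 : H₃ ≠ H₄) (n13 : H₁ ≠ H₃) (n14 : H₁ ≠ H₄) (n23 : H₂ ≠ H₃)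
    (n24 : H₂ ≠ H₄)
    (t₁ : (A ∩ H₁).card = ρ H₁) (t₂ : (A ∩ H₂).card = ρ H₂) (t₃ : (A' ∩ H₃).card = ρ H₃)
    (t₄ : (A' ∩ H₄).card = ρ H₄) {p : α} (hp1 : p ∉ H₁) (hp2 : p ∈ H₂) (hp3 : p ∈ H₃)
    (hp4 : p ∉ H₄) :
    (∃ z, z ∈ H₁ ∧ z ∈ H₂ ∧ z ∉ H₃ ∧ z ∉ H₄) ∨ ∃ z, z ∈ H₃ ∧ z ∈ H₄ ∧ z ∉ H₁ ∧ z ∉ H₂ := by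
  by_contra! hcon
  obtain ⟨hc1, hc2⟩ := hcon
  let χ : Finset α → α → ℕ := fun S x => if x ∈ S then 1 else 0
  have key : ∀ S T : Finset α, S ⊆ C → (S ∩ T).card = ∑ x ∈ C, χ S x * χ T x := by
    intro S T hS
    have : S ∩ T = C.filter (fun x => x ∈ S ∧ x ∈ T) := by
      ext x; simp only [Finset.mem_inter, Finset.mem_filter]
      exact ⟨fun hx => ⟨hS hx.1, hx⟩, fun hx => hx.2⟩
    rw [this, Finset.card_filter]
    refine Finset.sum_congr rfl fun x _ => ?_
    simp only [χ]; split_ifs <;> simp_all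
  have pair : ∀ {A L L'}, IsB A → 𝓛 L → 𝓛 L' → L ≠ L' → (A ∩ L).card = ρ L →
      (A ∩ L').card = ρ L' → ρ L + ρ L' ≤ k + (L ∩ L').card := by
    intro A L L' hA hL hL' _ t t'
    have c := card_inter_add A L L'
    have c1 : (A ∩ (L ∪ L')).card ≤ (A ∩ C).card := Finset.card_le_card
      (Finset.inter_subset_inter_left (Finset.union_subset (h.subset hL) (h.subset hL')))
    have c2 : (A ∩ (L ∩ L')).card ≤ (L ∩ L').card :=
      Finset.card_le_card Finset.inter_subset_right
    have c3 := h.card_inter hA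
    omega
  have p12 := pair hA h₁ h₂ n12 t₁ t₂
  have p34 := pair hA' h₃ h₄ n34 t₃ t₄
  have i13 := h.inter_le h₁ h₃ n13
  have i14 := h.inter_le h₁ h₄ n14
  have i23 := h.inter_le h₂ h₃ n23
  have i24 := h.inter_le h₂ h₄ n24
  -- If `x` lies in `a` of `H₁, H₂` and in `b` of `H₃, H₄`, the right summand is `a * b`, and the
  -- left one exceeds it only for `(a, b) = (2, 0)` or `(0, 2)`, which are excluded. At `p` it is `0
  -- < 1`. The bounds `p12`, `p34` and `i13` to `i24` force the opposite inequality between the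
  -- sums.
  have lt : ∑ x ∈ C, (2 * (χ H₁ x * χ H₂ x) + 2 * (χ H₃ x * χ H₄ x)) <
      ∑ x ∈ C, (χ H₁ x * χ H₃ x + χ H₁ x * χ H₄ x + χ H₂ x * χ H₃ x + χ H₂ x * χ H₄ x) := by
    apply Finset.sum_lt_sum
    · intro x _
      have := hc1 x
      have := hc2 x
      by_cases x ∈ H₁ <;> by_cases x ∈ H₂ <;> by_cases x ∈ H₃ <;> by_cases x ∈ H₄ <;>
        simp_all [χ]
    · exact ⟨p, h.subset h₂ hp2, by simp [χ, hp1, hp2, hp3, hp4]⟩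
  simp only [Finset.sum_add_distrib, ← Finset.mul_sum] at lt
  rw [← key _ _ (h.subset h₁), ← key _ _ (h.subset h₃), ← key _ _ (h.subset h₁),
    ← key _ _ (h.subset h₁), ← key _ _ (h.subset h₂), ← key _ _ (h.subset h₂)] at lt
  omega

end SplitSystem

/-! ### Symmetry and invariants of pair exchanges -/

namespace PairExchange

variable {α : Type*} [DecidableEq α] {IsB : Finset α → Prop}

theorem swap {p q : Finset α × Finset α} (h : PairExchange IsB p q) :
    PairExchange IsB p.swap q.swap := by
  obtain ⟨e, he, f, hf, h1, h2, rfl⟩ := h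
  exact ⟨f, hf, e, he, h2, h1, rfl⟩

theorem reflTransGen_swap {p q : Finset α × Finset α}
    (h : Relation.ReflTransGen (PairExchange IsB) p q) :
    Relation.ReflTransGen (PairExchange IsB) p.swap q.swap := by
  induction h with
  | refl => exact .refl
  | tail _ h ih => exact ih.tail h.swap

theorem inter_union {p q : Finset α × Finset α} (h : PairExchange IsB p q) :
    q.1 ∩ q.2 = p.1 ∩ p.2 ∧ q.1 ∪ q.2 = p.1 ∪ p.2 := by
  obtain ⟨e, he, f, hf, h1, h2, rfl⟩ := h
  rw [Finset.mem_sdiff] at he hf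
  have hne : e ≠ f := by rintro rfl; exact hf.2 he.1
  constructor <;> ext x <;> simp only [Finset.mem_inter, Finset.mem_union, Finset.mem_insert,
    Finset.mem_erase] <;> grind

theorem reflTransGen_invariant {p q : Finset α × Finset α}
    (h : Relation.ReflTransGen (PairExchange IsB) p q) (h1 : IsB p.1) (h2 : IsB p.2) :
    IsB q.1 ∧ IsB q.2 ∧ q.1 ∩ q.2 = p.1 ∩ p.2 ∧ q.1 ∪ q.2 = p.1 ∪ p.2 := by
  induction h with
  | refl => exact ⟨h1, h2, rfl, rfl⟩
  | tail _ h ih =>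
    obtain ⟨-, -, i, u⟩ := ih
    have := h.inter_union
    obtain ⟨e, he, f, hf, b1, b2, rfl⟩ := h
    exact ⟨b1, b2, this.1.trans i, this.2.trans u⟩

end PairExchange

/-! ### Reducing the distance to the target -/

namespace SplitSystem

variable {α : Type*} [DecidableEq α] {IsB : Finset α → Prop} {C : Finset α} {k : ℕ}
  {𝓛 : Finset α → Prop} {ρ : Finset α → ℕ}

theorem sdiff_eq_of_compatible {A A' B B' : Finset α} (hI : A ∩ A' = B ∩ B')
    (hU : A ∪ A' = B ∪ B') : A \ B = B' \ A' := by
  ext x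
  have h1 := Finset.ext_iff.1 hI x
  have h2 := Finset.ext_iff.1 hU x
  simp only [Finset.mem_inter, Finset.mem_union, Finset.mem_sdiff] at *
  tauto

/-- The distance to the target may be measured in either member of the pair, so arguments apply with
the two members interchanged. -/
theorem card_sdiff_eq_of_compatible (hcard : ∀ {A B}, IsB A → IsB B → A.card = B.card)
    {A A' B B' : Finset α} (hA' : IsB A') (hB' : IsB B')
    (hI : A ∩ A' = B ∩ B') (hU : A ∪ A' = B ∪ B') : (A \ B).card = (A' \ B').card := by
  rw [sdiff_eq_of_compatible hI hU, Finset.card_sdiff_comm (hcard hA' hB')]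

/-- Suppose the distance cannot be lowered. Every exchange of some `x ∈ A \ B` with some `y ∈ B \ A`
inside `C` is then blocked by a set tight at `A` or at `A'`. Rigidity of tight sets leaves just four
of them, in the cyclic position from which a detour exists. -/
theorem exists_closer_of_not (h : SplitSystem IsB C k 𝓛 ρ)
    (hcard : ∀ {A B}, IsB A → IsB B → A.card = B.card) {A A' B B' : Finset α}
    (hA : IsB A) (hA' : IsB A') (hB : IsB B) (hB' : IsB B')
    (hI : A ∩ A' = B ∩ B') (hU : A ∪ A' = B ∪ B') {e f : α} (he : e ∈ A \ B) (heC : e ∈ C)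
    (hf : f ∈ B \ A) (hfC : f ∈ C) (hn : ¬ IsB (insert f (A.erase e))) :
    ∃ q, Relation.ReflTransGen (PairExchange IsB) (A, A') q ∧ (q.1 \ B).card < (A \ B).card := by
  by_contra! hcon
  have hD : ∀ x, x ∈ A \ B → x ∈ A \ A' := by
    intro x hx
    have h1 := Finset.ext_iff.1 hI x
    simp only [Finset.mem_inter, Finset.mem_sdiff] at *; tauto
  have hD' : ∀ x, x ∈ B \ A → x ∈ A' \ A := by
    intro x hx
    have h1 := Finset.ext_iff.1 hU x
    simp only [Finset.mem_union, Finset.mem_sdiff] at *; tauto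
  have hDe : A \ B = B' \ A' := sdiff_eq_of_compatible hI hU
  have hDe' : B \ A = A' \ B' := sdiff_eq_of_compatible hI.symm hU.symm
  have closer : ∀ {q : Finset α × Finset α} {x f g : α}, q.1 ⊆ insert f (insert g (A.erase x)) →
      x ∈ A \ B → f ∈ B \ A → g ∈ B \ A → (q.1 \ B).card < (A \ B).card := by
    intro q x f g hq hx hf hg
    apply Finset.card_lt_card
    rw [Finset.ssubset_iff_of_subset]
    · refine ⟨x, hx, ?_⟩
      intro hx'
      have := hq (Finset.mem_sdiff.1 hx').1
      simp only [Finset.mem_insert, Finset.mem_erase, Finset.mem_sdiff] at *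
      grind
    · intro y hy
      have := hq (Finset.mem_sdiff.1 hy).1
      simp only [Finset.mem_insert, Finset.mem_erase, Finset.mem_sdiff] at *
      grind
  have stuck : ∀ x y, x ∈ A \ B → y ∈ B \ A → IsB (insert y (A.erase x)) →
      ¬ IsB (insert x (A'.erase y)) := by
    intro x y hx hy b b'
    refine absurd (hcon _ (.single ⟨x, hD x hx, y, hD' y hy, b, b', rfl⟩)) (not_le.2 ?_)
    exact closer (f := y) (g := y) (by simp) hx hy hy
  have mem : ∀ {x}, x ∈ A \ B → x ∈ A ∧ x ∉ A' := fun hx => Finset.mem_sdiff.1 (hD _ hx)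
  have mem' : ∀ {x}, x ∈ B \ A → x ∈ A' ∧ x ∉ A := fun hx => Finset.mem_sdiff.1 (hD' _ hx)
  obtain ⟨H₁, h₁, t₁, he1, hf1⟩ := h.exists_tight hA (mem he).1 heC hfC (mem' hf).2 hn
  have hH₁C := h.subset h₁
  have alt : ∀ x y, x ∈ A \ B → y ∈ B \ A → x ∈ C → y ∈ C →
      (¬ ∃ L, 𝓛 L ∧ (A ∩ L).card = ρ L ∧ x ∉ L ∧ y ∈ L) →
      ∃ L, 𝓛 L ∧ (A' ∩ L).card = ρ L ∧ y ∉ L ∧ x ∈ L := by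
    intro x y hx hy hxC hyC hno
    have b : IsB (insert y (A.erase x)) := by
      by_contra hb
      exact hno (h.exists_tight hA (mem hx).1 hxC hyC (mem' hy).2 hb)
    exact h.exists_tight hA' (mem' hy).1 hyC hxC (mem hx).2 (stuck x y hx hy b)
  have cardD : ∀ {A B : Finset α} {L : Finset α}, (A ∩ L).card + ((B \ A) ∩ L).card
      = (B ∩ L).card + ((A \ B) ∩ L).card := by
    intro A B L
    have h1 := Finset.card_sdiff_add_card_inter (A ∩ L) (B ∩ L)
    have h2 := Finset.card_sdiff_add_card_inter (B ∩ L) (A ∩ L)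
    have e1 : (A ∩ L) \ (B ∩ L) = (A \ B) ∩ L := by ext; simp; tauto
    have e2 : (B ∩ L) \ (A ∩ L) = (B \ A) ∩ L := by ext; simp; tauto
    rw [e1] at h1; rw [e2] at h2
    rw [Finset.inter_comm (B ∩ L)] at h2
    omega
  have cC := cardD (A := A) (B := B) (L := C)
  rw [h.card_inter hA, h.card_inter hB] at cC
  have c1 := cardD (A := A) (B := B) (L := H₁)
  have l1 := h.le hB h₁
  -- `H₁` is tight at `A` but holds at most `ρ H₁` elements of `B`, so passing from `A` to `B`
  -- removes from `H₁` at least as many elements as it adds, and it adds `f`. Since `e` is removed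
  -- outside `H₁`, within `C` some `g` must be added outside `H₁`.
  obtain ⟨e₂, he₂, he₂1⟩ : ∃ x, x ∈ A \ B ∧ x ∈ H₁ := by
    have : 0 < ((B \ A) ∩ H₁).card := Finset.card_pos.2 ⟨f, Finset.mem_inter.2 ⟨hf, hf1⟩⟩
    obtain ⟨x, hx⟩ := Finset.card_pos.1 (show 0 < ((A \ B) ∩ H₁).card by omega)
    exact ⟨x, Finset.mem_inter.1 hx⟩
  obtain ⟨g, hg, hgC, hg1⟩ : ∃ y, y ∈ B \ A ∧ y ∈ C ∧ y ∉ H₁ := by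
    by_contra! hall
    have s1 : (B \ A) ∩ C ⊆ (B \ A) ∩ H₁ := fun y hy =>
      Finset.mem_inter.2 ⟨(Finset.mem_inter.1 hy).1, hall y (Finset.mem_inter.1 hy).1
        (Finset.mem_inter.1 hy).2⟩
    have s2 : (A \ B) ∩ H₁ ⊂ (A \ B) ∩ C := by
      rw [Finset.ssubset_iff_of_subset (Finset.inter_subset_inter_left hH₁C)]
      exact ⟨e, Finset.mem_inter.2 ⟨he, heC⟩, fun hh => he1 (Finset.mem_inter.1 hh).2⟩
    have := Finset.card_le_card s1
    have := Finset.card_lt_card s2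
    omega
  have he₂C := hH₁C he₂1
  -- the pair `(e, g)` is blocked by a set tight at `A'`
  obtain ⟨H₃, h₃, t₃, hg3, he3⟩ := alt e g he hg heC hgC (by
    rintro ⟨L, hL, tL, heL, hgL⟩
    rw [h.tight_eq_of_notMem hA hL h₁ tL t₁ (mem he).1 heC heL he1] at hgL
    exact hg1 hgL)
  obtain ⟨H₄, h₄, t₄, hf4, he₂4⟩ := alt e₂ f he₂ hf he₂C hfC (by
    rintro ⟨L, hL, tL, heL, hfL⟩
    rw [h.tight_eq_of_mem hA hL h₁ tL t₁ (mem' hf).2 hfL hf1] at heL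
    exact heL he₂1)
  -- Outside `H₁` nothing tight at `A` blocks an exchange, so sets tight at `A'` do, and by rigidity
  -- they all equal `H₃`. The same reasoning inside `H₁` gives `H₄`.
  have inH3 : ∀ x y, x ∈ A \ B → x ∉ H₁ → x ∈ C → y ∈ B \ A → y ∉ H₁ → y ∈ C →
      x ∈ H₃ ∧ y ∉ H₃ := by
    have step : ∀ x y, x ∈ A \ B → x ∉ H₁ → x ∈ C → y ∈ B \ A → y ∉ H₁ → y ∈ C →
        ∃ L, 𝓛 L ∧ (A' ∩ L).card = ρ L ∧ y ∉ L ∧ x ∈ L := by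
      intro x y hx hx1 hxC hy hy1 hyC
      refine alt x y hx hy hxC hyC ?_
      rintro ⟨L, hL, tL, hxL, hyL⟩
      rw [h.tight_eq_of_notMem hA hL h₁ tL t₁ (mem hx).1 hxC hxL hx1] at hyL
      exact hy1 hyL
    intro x y hx hx1 hxC hy hy1 hyC
    constructor
    · obtain ⟨L, hL, tL, hgL, hxL⟩ := step x g hx hx1 hxC hg hg1 hgC
      rwa [h.tight_eq_of_notMem hA' hL h₃ tL t₃ (mem' hg).1 hgC hgL hg3] at hxL
    · obtain ⟨L, hL, tL, hyL, heL⟩ := step e y he he1 heC hy hy1 hyC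
      rwa [h.tight_eq_of_mem hA' hL h₃ tL t₃ (mem he).2 heL he3] at hyL
  have inH4 : ∀ x y, x ∈ A \ B → x ∈ H₁ → y ∈ B \ A → y ∈ H₁ → x ∈ H₄ ∧ y ∉ H₄ := by
    have step : ∀ x y, x ∈ A \ B → x ∈ H₁ → y ∈ B \ A → y ∈ H₁ →
        ∃ L, 𝓛 L ∧ (A' ∩ L).card = ρ L ∧ y ∉ L ∧ x ∈ L := by
      intro x y hx hx1 hy hy1
      refine alt x y hx hy (hH₁C hx1) (hH₁C hy1) ?_
      rintro ⟨L, hL, tL, hxL, hyL⟩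
      rw [h.tight_eq_of_mem hA hL h₁ tL t₁ (mem' hy).2 hyL hy1] at hxL
      exact hxL hx1
    intro x y hx hx1 hy hy1
    constructor
    · obtain ⟨L, hL, tL, hfL, hxL⟩ := step x f hx hx1 hf hf1
      rwa [h.tight_eq_of_notMem hA' hL h₄ tL t₄ (mem' hf).1 hfC hfL hf4] at hxL
    · obtain ⟨L, hL, tL, hyL, heL⟩ := step e₂ y he₂ he₂1 hy hy1
      rwa [h.tight_eq_of_mem hA' hL h₄ tL t₄ (mem he₂).2 heL he₂4] at hyL
  -- If the sets coincided, `H₃` would miss all of `B \ A = A' \ B'` and contain `e ∈ B' \ A'`, so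
  -- `B'` would exceed its capacity.
  have n34 : H₃ ≠ H₄ := by
    rintro rfl
    have c3 := cardD (A := A') (B := B') (L := H₃)
    have l3 := h.le hB' h₃
    rw [← hDe, ← hDe'] at c3
    have z : (B \ A) ∩ H₃ = ∅ := by
      ext y
      simp only [Finset.mem_inter, Finset.notMem_empty, iff_false, not_and]
      intro hy hy3
      by_cases hy1 : y ∈ H₁
      · exact (inH4 e₂ y he₂ he₂1 hy hy1).2 hy3
      · exact (inH3 e y he he1 heC hy hy1 (h.subset h₃ hy3)).2 hy3
    have : 0 < ((A \ B) ∩ H₃).card := Finset.card_pos.2 ⟨e, Finset.mem_inter.2 ⟨he, he3⟩⟩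
    rw [z] at c3
    simp at c3
    simp only [Finset.card_pos] at this
    have := Finset.card_pos.2 this
    omega
  have he4 : e ∉ H₄ := fun hh => n34 (h.tight_eq_of_mem hA' h₃ h₄ t₃ t₄ (mem he).2 he3 hh)
  have he₂3 : e₂ ∉ H₃ := fun hh => n34 (h.tight_eq_of_mem hA' h₃ h₄ t₃ t₄ (mem he₂).2 hh he₂4)
  have hf3 : f ∈ H₃ := by
    by_contra hh
    exact n34 (h.tight_eq_of_notMem hA' h₃ h₄ t₃ t₄ (mem' hf).1 hfC hh hf4)
  have hg4 : g ∈ H₄ := by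
    by_contra hh
    exact n34 (h.tight_eq_of_notMem hA' h₃ h₄ t₃ t₄ (mem' hg).1 hgC hg3 hh)
  -- A set tight at `A'` blocking `(e₂, g)` would miss `g`, hence be `H₃`, which does not contain
  -- `e₂`. So the block occurs at `A`. In the end `e`, `e₂`, `f`, `g` lie exactly in `H₂, H₃`; `H₁,
  -- H₄`; `H₁, H₃`; `H₂, H₄`.
  obtain ⟨H₂, h₂, t₂, he₂2, hg2⟩ : ∃ L, 𝓛 L ∧ (A ∩ L).card = ρ L ∧ e₂ ∉ L ∧ g ∈ L := by
    by_contra hno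
    obtain ⟨L, hL, tL, hgL, heL⟩ := alt e₂ g he₂ hg he₂C hgC hno
    rw [h.tight_eq_of_notMem hA' hL h₃ tL t₃ (mem' hg).1 hgC hgL hg3] at heL
    exact he₂3 heL
  have n12 : H₁ ≠ H₂ := by rintro rfl; exact hg1 hg2
  have he2 : e ∈ H₂ := by
    by_contra hh
    exact n12 (h.tight_eq_of_notMem hA h₁ h₂ t₁ t₂ (mem he).1 heC he1 hh)
  have hf2 : f ∉ H₂ := fun hh => n12 (h.tight_eq_of_mem hA h₁ h₂ t₁ t₂ (mem' hf).2 hf1 hh)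
  have n13 : H₁ ≠ H₃ := by rintro rfl; exact he1 he3
  have n14 : H₁ ≠ H₄ := by rintro rfl; exact hf4 hf1
  have n23 : H₂ ≠ H₃ := by rintro rfl; exact hf2 hf3
  have n24 : H₂ ≠ H₄ := by rintro rfl; exact he4 he2
  rcases h.exists_mem_of_cyclic hA hA' h₁ h₂ h₃ h₄ n12 n34 n13 n14 n23 n24 t₁ t₂ t₃ t₄ he1 he2 he3
    he4 with ⟨z, hz1, hz2, hz3, hz4⟩ | ⟨z, hz3, hz4, hz1, hz2⟩
  -- The element `z` may belong to `B`. Giving it up does no harm, since only elements outside `B`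
  -- are counted, and the detour removes `e₂` while adding only `f, g ∈ B`.
  · have hzA : z ∈ A :=
      (h.tight_pair hA h₁ h₂ n12 t₁ t₂).1 (Finset.mem_inter.2 ⟨hz1, hz2⟩)
    have hzA' : z ∉ A' := fun hh => by
      have := (h.tight_pair hA' h₃ h₄ n34 t₃ t₄).2 (Finset.mem_inter.2 ⟨hh, hH₁C hz1⟩)
      simp [hz3, hz4] at this
    obtain ⟨q, hq, hs⟩ := h.double_exchange hA hA' h₁ h₂ h₄ t₁ t₂ t₄
      (Finset.mem_sdiff.2 ⟨hzA, hzA'⟩) (hD _ he₂) (hD' _ hf) (hD' _ hg) hz1 hz2 hz4 hf1 hf2 hf4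
      he₂1 he₂2 he₂4 hg1 hg2 hg4
    exact absurd (hcon q hq) (not_le.2 (closer hs he₂ hf hg))
  -- The mirror image: the detour starts from `(A', A)`, exchanging `z` with `e` and then `f` with
  -- `e₂`, and progress is measured in the second member.
  · have hzA' : z ∈ A' :=
      (h.tight_pair hA' h₃ h₄ n34 t₃ t₄).1 (Finset.mem_inter.2 ⟨hz3, hz4⟩)
    have hzA : z ∉ A := fun hh => by
      have := (h.tight_pair hA h₁ h₂ n12 t₁ t₂).2
        (Finset.mem_inter.2 ⟨hh, h.subset h₃ hz3⟩)
      simp [hz1, hz2] at this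
    obtain ⟨q, hq, hs⟩ := h.double_exchange hA' hA h₃ h₄ h₁ t₃ t₄ t₁
      (Finset.mem_sdiff.2 ⟨hzA', hzA⟩) (hD' _ hf) (hD _ he) (hD _ he₂) hz3 hz4 hz1 he3 he4 he1
      hf3 hf4 hf1 he₂3 he₂4 he₂1
    have hq' := PairExchange.reflTransGen_swap hq
    obtain ⟨b1, b2, i, u⟩ := PairExchange.reflTransGen_invariant hq hA' hA
    refine absurd (hcon _ hq') (not_le.2 ?_)
    have e1 := card_sdiff_eq_of_compatible hcard hA' hB' hI hU
    have e2 := card_sdiff_eq_of_compatible (A := q.2) (A' := q.1) hcard b1 hB'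
      (by rw [Finset.inter_comm, i, Finset.inter_comm]; exact hI)
      (by rw [Finset.union_comm, u, Finset.union_comm]; exact hU)
    simp only [Prod.fst_swap]
    rw [e1, e2]
    apply Finset.card_lt_card
    have hf' := hDe' ▸ hf
    rw [Finset.ssubset_iff_of_subset]
    · refine ⟨f, hf', ?_⟩
      intro hx'
      have := hs (Finset.mem_sdiff.1 hx').1
      have := mem he
      have := mem he₂
      have := mem' hf
      simp only [Finset.mem_insert, Finset.mem_erase] at *
      grind
    · intro y hy
      have := hs (Finset.mem_sdiff.1 hy).1
      have m1 := hDe ▸ he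
      have m2 := hDe ▸ he₂
      simp only [Finset.mem_insert, Finset.mem_erase, Finset.mem_sdiff] at *
      grind

/-- A basis pair can be brought closer to a compatible one that differs from it inside `C`. -/
theorem exists_closer (h : SplitSystem IsB C k 𝓛 ρ)
    (hcard : ∀ {A B}, IsB A → IsB B → A.card = B.card) {A A' B B' : Finset α}
    (hA : IsB A) (hA' : IsB A') (hB : IsB B) (hB' : IsB B')
    (hI : A ∩ A' = B ∩ B') (hU : A ∪ A' = B ∪ B') {e : α} (he : e ∈ A \ B) (heC : e ∈ C) :
    ∃ q, Relation.ReflTransGen (PairExchange IsB) (A, A') q ∧ (q.1 \ B).card < (A \ B).card := by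
  obtain ⟨f, hf, hfC⟩ : ∃ f, f ∈ B \ A ∧ f ∈ C := by
    have h1 := Finset.card_sdiff_comm ((h.card_inter hA).trans (h.card_inter hB).symm)
    have : 0 < ((A ∩ C) \ (B ∩ C)).card := Finset.card_pos.2 ⟨e, by
      simp only [Finset.mem_sdiff, Finset.mem_inter] at *; tauto⟩
    rw [h1] at this
    obtain ⟨f, hf⟩ := Finset.card_pos.1 this
    refine ⟨f, ?_⟩
    simp only [Finset.mem_sdiff, Finset.mem_inter] at *; tauto
  by_cases b : IsB (insert f (A.erase e))
  · by_cases b' : IsB (insert e (A'.erase f))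
    · have hDe : A \ B = B' \ A' := sdiff_eq_of_compatible hI hU
      have hDe' : B \ A = A' \ B' := sdiff_eq_of_compatible hI.symm hU.symm
      have m1 := hDe ▸ he
      have m2 := hDe' ▸ hf
      refine ⟨_, .single ⟨e, ?_, f, ?_, b, b', rfl⟩, ?_⟩
      · simp only [Finset.mem_sdiff] at *; tauto
      · simp only [Finset.mem_sdiff] at *; tauto
      · apply Finset.card_lt_card
        rw [Finset.ssubset_iff_of_subset]
        · refine ⟨e, he, ?_⟩
          simp only [Finset.mem_sdiff, Finset.mem_insert, Finset.mem_erase] at *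
          grind
        · intro y
          simp only [Finset.mem_sdiff, Finset.mem_insert, Finset.mem_erase] at *
          grind
    -- The exchange fails at `A'` instead, so the two members swap roles.
    · have hDe : A \ B = B' \ A' := sdiff_eq_of_compatible hI hU
      have hDe' : B \ A = A' \ B' := sdiff_eq_of_compatible hI.symm hU.symm
      have I' : A' ∩ A = B' ∩ B := by rw [Finset.inter_comm, hI, Finset.inter_comm]
      have U' : A' ∪ A = B' ∪ B := by rw [Finset.union_comm, hU, Finset.union_comm]
      obtain ⟨q, hq, hlt⟩ := h.exists_closer_of_not hcard hA' hA hB' hB I' U' (hDe' ▸ hf) hfC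
        (hDe ▸ he) heC b'
      obtain ⟨b1, b2, i, u⟩ := PairExchange.reflTransGen_invariant hq hA' hA
      refine ⟨q.swap, PairExchange.reflTransGen_swap hq, ?_⟩
      rw [card_sdiff_eq_of_compatible hcard hA' hB' hI hU]
      rw [card_sdiff_eq_of_compatible hcard b2 hB (i.trans I') (u.trans U')] at hlt
      exact hlt
  · exact h.exists_closer_of_not hcard hA hA' hB hB' hI hU he heC hf hfC b

end SplitSystem

/-! ### Bases, exchange classes and tight sets from circuits -/

namespace Matroid

variable {α : Type*}

theorem IsBase.card_eq {M : Matroid α} {A B : Finset α} (hA : M.IsBase (A : Set α))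
    (hB : M.IsBase (B : Set α)) : A.card = B.card := by
  have := hA.encard_eq_encard_of_isBase hB
  simpa [Set.encard_coe_eq_coe_finsetCard] using this

theorem exists_finset_of_isBase {M : Matroid α} [M.Finite] {B : Set α} (hB : M.IsBase B) :
    ∃ A : Finset α, (A : Set α) = B :=
  (M.ground_finite.subset hB.subset_ground).exists_finset_coe

variable [DecidableEq α]

/-- Extend `I + g` to a base inside `A + g`; by cardinality it omits exactly one element of `A`,
necessarily outside `I`. -/
theorem IsBase.exists_swap {M : Matroid α} [M.Finite] {A I : Finset α} {g : α}
    (hA : M.IsBase (A : Set α)) (hI : I ⊆ A) (hg : g ∉ A)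
    (hi : M.Indep (insert g (I : Set α))) :
    ∃ h ∈ A, h ∉ I ∧ M.IsBase ((insert g (A.erase h) : Finset α) : Set α) := by
  obtain ⟨B', hB', h1, h2⟩ := hi.exists_isBase_subset_union_isBase hA
  obtain ⟨B, rfl⟩ := exists_finset_of_isBase hB'
  have hc := hA.card_eq hB'
  have hsub : B ⊆ insert g A := by
    intro x hx
    have := h2 hx
    simp only [Set.mem_union, Set.mem_insert_iff, Finset.mem_coe, Finset.mem_insert] at *
    rcases this with (h | h) | h
    · exact .inl h
    · exact .inr (hI h)
    · exact .inr h
  have hgB : g ∈ B := h1 (Set.mem_insert _ _)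
  have hBA : B \ A = {g} := by
    ext x
    simp only [Finset.mem_sdiff, Finset.mem_singleton]
    constructor
    · rintro ⟨hx, hxA⟩
      simpa [hxA] using hsub hx
    · rintro rfl; exact ⟨hgB, hg⟩
  have hAB : (A \ B).card = 1 := by
    rw [Finset.card_sdiff_comm hc, hBA, Finset.card_singleton]
  obtain ⟨h, hh⟩ := Finset.card_eq_one.1 hAB
  have hm : h ∈ A \ B := hh ▸ Finset.mem_singleton_self h
  rw [Finset.mem_sdiff] at hm
  refine ⟨h, hm.1, fun hI' => hm.2 (h1 (Set.mem_insert_of_mem _ hI')), ?_⟩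
  convert hB'
  ext x
  have e1 := Finset.ext_iff.1 hh x
  have e2 := Finset.ext_iff.1 hBA x
  simp only [Finset.mem_sdiff, Finset.mem_singleton, Finset.mem_insert, Finset.mem_erase] at *
  grind

/-- A base that admits no exchange moving an element into `L` meets `L` in as many elements as
possible. -/
theorem IsBase.card_inter_le_of_forall {M : Matroid α} [M.Finite] {A L : Finset α}
    (hA : M.IsBase (A : Set α))
    (hL : ∀ g ∈ L, g ∉ A → ∀ h ∈ A, h ∉ L → ¬ M.IsBase ((insert g (A.erase h) : Finset α) : Set α))
    {B : Finset α} (hB : M.IsBase (B : Set α)) : (B ∩ L).card ≤ (A ∩ L).card := by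
  by_contra! hlt
  have i1 : M.Indep ((A ∩ L : Finset α) : Set α) := hA.indep.subset (by simp)
  have i2 : M.Indep ((B ∩ L : Finset α) : Set α) := hB.indep.subset (by simp)
  obtain ⟨g, hg, hi⟩ := i1.augment i2 (by
    simpa only [Set.encard_coe_eq_coe_finsetCard, Nat.cast_lt] using hlt)
  simp only [Finset.coe_inter, Set.mem_sdiff, Set.mem_inter_iff, Finset.mem_coe, not_and] at hg
  have hgA : g ∉ A := fun h => hg.2 h hg.1.2
  obtain ⟨h, hhA, hhI, hb⟩ := hA.exists_swap Finset.inter_subset_left hgA hi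
  exact hL g hg.1.2 hgA h hhA (fun hh => hhI (Finset.mem_inter.2 ⟨hhA, hh⟩)) hb

/-- `f` can replace `e` in some base. -/
def ExchRel (M : Matroid α) (e f : α) : Prop :=
  ∃ B : Finset α, M.IsBase (B : Set α) ∧ e ∈ B ∧ f ∉ B ∧
    M.IsBase ((insert f (B.erase e) : Finset α) : Set α)

open scoped Classical in
/-- The class of `x` for the equivalence relation generated by `ExchRel`, i.e. its connected
component in `M`. -/
noncomputable def exchClass (M : Matroid α) [M.Finite] (x : α) : Finset α :=
  M.ground_finite.toFinset.filter fun y => Relation.EqvGen M.ExchRel x y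

variable {M : Matroid α} [M.Finite]

theorem mem_exchClass {x y : α} :
    y ∈ M.exchClass x ↔ y ∈ M.E ∧ Relation.EqvGen M.ExchRel x y := by
  simp [exchClass]

theorem mem_exchClass_iff_of_isBase {x e f : α} {B : Finset α} (hB : M.IsBase (B : Set α))
    (he : e ∈ B) (hf : f ∉ B) (hb : M.IsBase ((insert f (B.erase e) : Finset α) : Set α)) :
    e ∈ M.exchClass x ↔ f ∈ M.exchClass x := by
  have h : M.ExchRel e f := ⟨B, hB, he, hf, hb⟩
  have heE : e ∈ M.E := hB.subset_ground he
  have hfE : f ∈ M.E := hb.subset_ground (by simp)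
  simp only [mem_exchClass, heE, hfE, true_and]
  exact ⟨fun h' => h'.trans _ _ _ (.rel _ _ h), fun h' => h'.trans _ _ _ (.symm _ _ (.rel _ _ h))⟩

/-- No exchange crosses the boundary of a class, so every base meets the class in a maximum number
of elements. -/
theorem card_inter_exchClass_le (x : α) {A B : Finset α} (hA : M.IsBase (A : Set α))
    (hB : M.IsBase (B : Set α)) : (B ∩ M.exchClass x).card ≤ (A ∩ M.exchClass x).card :=
  hA.card_inter_le_of_forall (fun _ hg hgA _ hh hhL hb =>
    hhL ((mem_exchClass_iff_of_isBase hA hh hgA hb).2 hg)) hB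

theorem card_inter_exchClass (x : α) {A B : Finset α} (hA : M.IsBase (A : Set α))
    (hB : M.IsBase (B : Set α)) : (A ∩ M.exchClass x).card = (B ∩ M.exchClass x).card :=
  (card_inter_exchClass_le x hB hA).antisymm (card_inter_exchClass_le x hA hB)

/-- The greedy property: a base of maximum weight has as many elements as possible above each
threshold, separately in each component. -/
theorem IsBase.card_inter_filter_le_of_max {x : α} {A : Finset α} (hA : M.IsBase (A : Set α))
    (c : α → ℝ) (hmax : ∀ B : Finset α, M.IsBase (B : Set α) → ∑ i ∈ B, c i ≤ ∑ i ∈ A, c i) (t : ℝ)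
    {B : Finset α} (hB : M.IsBase (B : Set α)) :
    (B ∩ (M.exchClass x).filter fun g => t < c g).card ≤
      (A ∩ (M.exchClass x).filter fun g => t < c g).card := by
  refine hA.card_inter_le_of_forall (fun g hg hgA h hh hhL hb => ?_) hB
  rw [Finset.mem_filter] at hg
  have hhC := (mem_exchClass_iff_of_isBase hA hh hgA hb).2 hg.1
  have hct : ¬ t < c h := fun hc => hhL (Finset.mem_filter.2 ⟨hhC, hc⟩)
  have := hmax _ hb
  rw [Finset.sum_insert (by simp [hgA]), ← Finset.add_sum_erase A c hh] at this
  linarith [hg.2]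

/-- The fundamental circuit of `f` separates `f` from an element it cannot replace. -/
theorem IsBase.exists_tight {x : α} {A : Finset α} (hA : M.IsBase (A : Set α)) {e f : α}
    (he : e ∈ A) (hf : f ∉ A) (hfC : f ∈ M.exchClass x)
    (hn : ¬ M.IsBase ((insert f (A.erase e) : Finset α) : Set α)) :
    ∃ L ⊆ M.exchClass x, (∀ B : Finset α, M.IsBase (B : Set α) → (B ∩ L).card ≤ (A ∩ L).card) ∧
      e ∉ L ∧ f ∈ L := by
  classical
  refine ⟨insert f (A.filter fun g => M.IsBase ((insert f (A.erase g) : Finset α) : Set α)),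
    ?_, fun B hB => ?_, ?_, Finset.mem_insert_self _ _⟩
  · intro g hg
    rw [Finset.mem_insert, Finset.mem_filter] at hg
    rcases hg with rfl | ⟨hg, hb⟩
    · exact hfC
    · exact (mem_exchClass_iff_of_isBase hA hg hf hb).2 hfC
  · refine hA.card_inter_le_of_forall (fun g hg hgA h hh hhL hb => hhL ?_) hB
    rw [Finset.mem_insert, Finset.mem_filter] at hg ⊢
    rcases hg with rfl | ⟨hg, -⟩
    · exact .inr ⟨hh, hb⟩
    · exact absurd hg hgA
  · rw [Finset.mem_insert, Finset.mem_filter]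
    rintro (h | h)
    · exact hf (h ▸ he)
    · exact hn h.2

end Matroid

/-! ### Indicator vectors and coordinate sums -/

/-- The indicator vector of a finite set. -/
noncomputable def indVec {α : Type*} (B : Finset α) : α → ℝ := (B : Set α).indicator 1

/-- The sum of the coordinates in `L`. -/
noncomputable def coordSum {α : Type*} (L : Finset α) : StrongDual ℝ (α → ℝ) :=
  ∑ i ∈ L, ContinuousLinearMap.proj i

theorem coordSum_apply {α : Type*} (L : Finset α) (x : α → ℝ) : coordSum L x = ∑ i ∈ L, x i := by
  simp [coordSum]

theorem indVec_apply {α : Type*} [DecidableEq α] (B : Finset α) (i : α) :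
    indVec B i = if i ∈ B then 1 else 0 := by
  simp [indVec, Set.indicator_apply]

theorem coordSum_indVec {α : Type*} [DecidableEq α] (L B : Finset α) :
    coordSum L (indVec B) = (B ∩ L).card := by
  rw [coordSum_apply]
  simp [indVec_apply, Finset.inter_comm B L]

theorem indVec_eq_sum {α : Type*} [DecidableEq α] (B : Finset α) :
    indVec B = ∑ i ∈ B, (Pi.single i (1 : ℝ) : α → ℝ) := by
  ext j
  rw [indVec_apply, Finset.sum_apply]
  simp [Pi.single_apply]

theorem coordSum_single {α : Type*} [DecidableEq α] (L : Finset α) (i : α) :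
    coordSum L (Pi.single i (1 : ℝ) : α → ℝ) = if i ∈ L then 1 else 0 := by
  rw [coordSum_apply]
  simp [Pi.single_apply]

/-! ### Facets of the base polytope that witness failed exchanges -/

namespace Matroid

variable {α : Type*}

/-- The vertices of the base polytope. -/
def baseVecs (M : Matroid α) : Set (α → ℝ) := {x | ∃ B, M.IsBase B ∧ x = B.indicator 1}

theorem indVec_mem_baseVecs {M : Matroid α} {B : Finset α} (hB : M.IsBase (B : Set α)) :
    indVec B ∈ M.baseVecs := ⟨B, hB, rfl⟩

open scoped Classical in
/-- The bases as finite sets. -/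
noncomputable def baseFinset (M : Matroid α) [M.Finite] : Finset (Finset α) :=
  M.ground_finite.toFinset.powerset.filter fun B => M.IsBase (B : Set α)

theorem mem_baseFinset {M : Matroid α} [M.Finite] {B : Finset α} :
    B ∈ M.baseFinset ↔ M.IsBase (B : Set α) := by
  simp only [baseFinset, Finset.mem_filter, Finset.mem_powerset, and_iff_right_iff_imp]
  intro h x hx
  simpa using h.subset_ground hx

theorem mem_baseVecs {M : Matroid α} [M.Finite] {x : α → ℝ} :
    x ∈ M.baseVecs ↔ ∃ B : Finset α, M.IsBase (B : Set α) ∧ x = indVec B := by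
  constructor
  · rintro ⟨B, hB, rfl⟩
    obtain ⟨A, rfl⟩ := exists_finset_of_isBase hB
    exact ⟨A, hB, rfl⟩
  · rintro ⟨B, hB, rfl⟩; exact indVec_mem_baseVecs hB

theorem baseVecs_finite (M : Matroid α) [M.Finite] : M.baseVecs.Finite := by
  refine (M.baseFinset.finite_toSet.image indVec).subset ?_
  intro x hx
  obtain ⟨B, hB, rfl⟩ := mem_baseVecs.1 hx
  exact ⟨B, mem_baseFinset.2 hB, rfl⟩

theorem affineSpan_basePolytope (M : Matroid α) :
    affineSpan ℝ (basePolytope M) = affineSpan ℝ M.baseVecs := affineSpan_convexHull _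

theorem vectorSpan_basePolytope (M : Matroid α) :
    vectorSpan ℝ (basePolytope M) = vectorSpan ℝ M.baseVecs := by
  rw [← direction_affineSpan, affineSpan_basePolytope, direction_affineSpan]

theorem indVec_sub_mem {M : Matroid α} {A B : Finset α} (hA : M.IsBase (A : Set α))
    (hB : M.IsBase (B : Set α)) : indVec A - indVec B ∈ vectorSpan ℝ M.baseVecs :=
  vsub_mem_vectorSpan ℝ (indVec_mem_baseVecs hA) (indVec_mem_baseVecs hB)

variable [DecidableEq α] {M : Matroid α} [M.Finite]

/-- The largest number of elements of `L` in a base. -/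
noncomputable def capacity (M : Matroid α) [M.Finite] (L : Finset α) : ℕ :=
  M.baseFinset.sup fun B => (B ∩ L).card

theorem IsBase.card_inter_le_capacity {B : Finset α} (hB : M.IsBase (B : Set α)) (L : Finset α) :
    (B ∩ L).card ≤ M.capacity L :=
  Finset.le_sup (f := fun B : Finset α => (B ∩ L).card) (mem_baseFinset.2 hB)

theorem capacity_eq {A L : Finset α} (hA : M.IsBase (A : Set α))
    (h : ∀ B : Finset α, M.IsBase (B : Set α) → (B ∩ L).card ≤ (A ∩ L).card) :
    M.capacity L = (A ∩ L).card :=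
  (Finset.sup_le fun B hB => h B (mem_baseFinset.1 hB)).antisymm (hA.card_inter_le_capacity L)

/-- The vertices of the face of the base polytope on which the coordinate sum over `L` is largest. -/
def tightVecs (M : Matroid α) [M.Finite] (L : Finset α) : Set (α → ℝ) :=
  {x | ∃ B : Finset α, M.IsBase (B : Set α) ∧ (B ∩ L).card = M.capacity L ∧ x = indVec B}

/-- A single base exchange gives the difference of two vertices, and these directions add up along a
chain of exchanges. -/
theorem single_sub_single_mem {x e f : α} (he : e ∈ M.exchClass x) (hf : f ∈ M.exchClass x) :
    (Pi.single f 1 - Pi.single e 1 : α → ℝ) ∈ vectorSpan ℝ M.baseVecs := by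
  have key : ∀ {a b : α}, Relation.EqvGen M.ExchRel a b →
      (Pi.single b 1 - Pi.single a 1 : α → ℝ) ∈ vectorSpan ℝ M.baseVecs := by
    intro a b h
    induction h with
    | rel a b h =>
      obtain ⟨B, hB, ha, hb, hb'⟩ := h
      have := indVec_sub_mem hb' hB
      rw [indVec_eq_sum, indVec_eq_sum, Finset.sum_insert (by simp [hb]),
        ← Finset.add_sum_erase B _ ha] at this
      simpa using this
    | refl a => simp
    | symm a b _ ih => rw [← neg_sub]; exact Submodule.neg_mem _ ih
    | trans a b c _ _ ih1 ih2 => simpa using Submodule.add_mem _ ih1 ih2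
  exact key ((mem_exchClass.1 he).2.symm.trans _ _ _ (mem_exchClass.1 hf).2)

theorem indVec_sub_mem_of_subset {x : α} {S T : Finset α} (hS : S ⊆ M.exchClass x)
    (hT : T ⊆ M.exchClass x) (hc : S.card = T.card) :
    indVec S - indVec T ∈ vectorSpan ℝ M.baseVecs := by
  rcases (M.exchClass x).eq_empty_or_nonempty with h0 | ⟨e, he⟩
  · rw [h0, Finset.subset_empty] at hS hT
    simp [hS, hT]
  have h : ∀ U ⊆ M.exchClass x, indVec U - (U.card : ℝ) • (Pi.single e 1 : α → ℝ) ∈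
      vectorSpan ℝ M.baseVecs := by
    intro U hU
    have : indVec U - (U.card : ℝ) • (Pi.single e 1 : α → ℝ) =
        ∑ i ∈ U, ((Pi.single i 1 : α → ℝ) - Pi.single e 1) := by
      rw [Finset.sum_sub_distrib, indVec_eq_sum, Finset.sum_const, Nat.cast_smul_eq_nsmul]
    rw [this]
    exact Submodule.sum_mem _ fun i hi => single_sub_single_mem he (hU hi)
  have := Submodule.sub_mem _ (h S hS) (h T hT)
  rw [hc] at this
  simpa using this

theorem tightVecs_subset (L : Finset α) : M.tightVecs L ⊆ M.baseVecs := by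
  rintro _ ⟨B, hB, -, rfl⟩; exact indVec_mem_baseVecs hB

theorem vectorSpan_tightVecs_le (L : Finset α) : vectorSpan ℝ (M.tightVecs L) ≤
    vectorSpan ℝ M.baseVecs ⊓ LinearMap.ker (coordSum L).toLinearMap := by
  refine le_inf (vectorSpan_mono ℝ (tightVecs_subset L)) ?_
  rw [vectorSpan_def, Submodule.span_le]
  rintro _ ⟨_, ⟨A, hA, tA, rfl⟩, _, ⟨B, hB, tB, rfl⟩, rfl⟩
  simp [coordSum_indVec, tA, tB]

/-- `L` lies in the class `C` and cuts out a facet of the base polytope that is not a facet of the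
hypersimplex. -/
structure IsFacetSet (M : Matroid α) [M.Finite] (x : α) (L : Finset α) : Prop where
  subset : L ⊆ M.exchClass x
  lt_card : M.capacity L < L.card
  exists_lt : ∃ A : Finset α, M.IsBase (A : Set α) ∧ (A ∩ L).card = M.capacity L ∧
    (A ∩ L).card < (A ∩ M.exchClass x).card
  vectorSpan_eq : vectorSpan ℝ (M.tightVecs L) =
    vectorSpan ℝ M.baseVecs ⊓ LinearMap.ker (coordSum L).toLinearMap

/-- If the face of `L` is not a facet, its supporting hyperplane can be rotated about it. -/
theorem exists_weight_of_ne {A L : Finset α} {e f : α} (hA : M.IsBase (A : Set α))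
    (hL : ∀ B : Finset α, M.IsBase (B : Set α) → (B ∩ L).card ≤ (A ∩ L).card)
    (heL : e ∉ L) (hfL : f ∈ L)
    (hne : vectorSpan ℝ (M.tightVecs L) ≠
      vectorSpan ℝ M.baseVecs ⊓ LinearMap.ker (coordSum L).toLinearMap) :
    ∃ b : (α → ℝ) →ₗ[ℝ] ℝ, b (Pi.single e 1) = b (Pi.single f 1) ∧
      (∀ B : Finset α, M.IsBase (B : Set α) → (B ∩ L).card = (A ∩ L).card →
        b (indVec B) = b (indVec A)) ∧
      ∃ B : Finset α, M.IsBase (B : Set α) ∧ b (indVec A) < b (indVec B) := by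
  set W := vectorSpan ℝ (M.tightVecs L) with hW
  set V := vectorSpan ℝ M.baseVecs with hV
  set u : α → ℝ := Pi.single f 1 - Pi.single e 1 with hu
  have hcap := capacity_eq hA hL
  have hφu : coordSum L u = 1 := by
    simp [hu, coordSum_single, heL, hfL]
  obtain ⟨v, ⟨hvV, hvk⟩, hvW⟩ := SetLike.exists_of_lt (lt_of_le_of_ne (vectorSpan_tightVecs_le L) hne)
  have hv : v ∉ W ⊔ Submodule.span ℝ {u} := by
    -- The coordinate sum vanishes on `v` and on `W` but is `1` on `u`, so a multiple of `u` cannot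
    -- help. The functional `b` obtained from this is constant on tight bases, does not distinguish
    -- `e` from `f`, and, as `v ∈ V`, is not constant on all bases; a sign change makes it larger
    -- somewhere.
    intro hmem
    obtain ⟨w, hw, y, hy, rfl⟩ := Submodule.mem_sup.1 hmem
    obtain ⟨r, rfl⟩ := Submodule.mem_span_singleton.1 hy
    have hwk := (vectorSpan_tightVecs_le L hw).2
    simp only [SetLike.mem_coe, LinearMap.mem_ker, ContinuousLinearMap.coe_coe, map_add, map_smul,
      hφu] at hvk hwk
    rw [hwk] at hvk
    have : r = 0 := by simpa using hvk
    subst this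
    simp only [zero_smul, add_zero] at hvW
    exact hvW hw
  obtain ⟨b, hbv, hb⟩ := Submodule.exists_le_ker_of_notMem hv
  have hbe : b (Pi.single e 1) = b (Pi.single f 1) := by
    have : u ∈ LinearMap.ker b :=
      hb (Submodule.mem_sup_right (Submodule.mem_span_singleton_self u))
    rw [LinearMap.mem_ker, hu, map_sub] at this
    linarith
  have hbt : ∀ B : Finset α, M.IsBase (B : Set α) → (B ∩ L).card = (A ∩ L).card →
      b (indVec B) = b (indVec A) := by
    intro B hB tB
    have : indVec B - indVec A ∈ LinearMap.ker b := hb (Submodule.mem_sup_left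
      (vsub_mem_vectorSpan ℝ ⟨B, hB, tB.trans hcap.symm, rfl⟩ ⟨A, hA, hcap.symm, rfl⟩))
    rw [LinearMap.mem_ker, map_sub] at this
    linarith
  obtain ⟨B, hB, hBb⟩ : ∃ B : Finset α, M.IsBase (B : Set α) ∧ b (indVec B) ≠ b (indVec A) := by
    by_contra! hall
    refine hbv ?_
    have : V ≤ LinearMap.ker b := by
      rw [hV, vectorSpan_def, Submodule.span_le]
      rintro _ ⟨p, hp, q, hq, rfl⟩
      obtain ⟨B, hB, rfl⟩ := mem_baseVecs.1 hp
      obtain ⟨B', hB', rfl⟩ := mem_baseVecs.1 hq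
      simp [hall B hB, hall B' hB']
    exact this hvV
  rcases lt_or_gt_of_ne hBb with hlt | hlt
  · exact ⟨-b, by simp [hbe], fun B hB tB => by simp [hbt B hB tB], B, hB, by simpa using hlt⟩
  · exact ⟨b, hbe, hbt, B, hB, hlt⟩

/-- If `f` cannot replace `e` in the base `A`, then some facet through `A` witnesses this. -/
theorem IsBase.exists_isFacetSet {x : α} {A : Finset α} {e f : α} (hA : M.IsBase (A : Set α))
    (he : e ∈ A) (heC : e ∈ M.exchClass x) (hf : f ∉ A) (hfC : f ∈ M.exchClass x)
    (hn : ¬ M.IsBase ((insert f (A.erase e) : Finset α) : Set α)) :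
    ∃ L, M.IsFacetSet x L ∧ (A ∩ L).card = M.capacity L ∧ e ∉ L ∧ f ∈ L := by
  classical
  let cand : Finset (Finset α) := (M.exchClass x).powerset.filter fun L =>
    (∀ B : Finset α, M.IsBase (B : Set α) → (B ∩ L).card ≤ (A ∩ L).card) ∧ e ∉ L ∧ f ∈ L
  have hcand : cand.Nonempty := by
    obtain ⟨L, hLC, h⟩ := hA.exists_tight he hf hfC hn
    exact ⟨L, Finset.mem_filter.2 ⟨Finset.mem_powerset.2 hLC, h⟩⟩
  -- Among the sets tight at `A` that separate `f` from `e`, take one whose face has the most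
  -- vertices.
  obtain ⟨L, hLc, hmax⟩ := cand.exists_max_image
    (fun L => (M.baseFinset.filter fun B => (B ∩ L).card = (A ∩ L).card).card) hcand
  obtain ⟨hLC, hL, heL, hfL⟩ := Finset.mem_filter.1 hLc
  rw [Finset.mem_powerset] at hLC
  have hcap := capacity_eq hA hL
  refine ⟨L, ⟨hLC, ?_, ⟨A, hA, hcap.symm, ?_⟩, ?_⟩, hcap.symm, heL, hfL⟩
  · rw [hcap]
    apply Finset.card_lt_card
    rw [Finset.ssubset_iff_of_subset Finset.inter_subset_right]
    exact ⟨f, hfL, fun h => hf (Finset.mem_inter.1 h).1⟩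
  · apply Finset.card_lt_card
    rw [Finset.ssubset_iff_of_subset (Finset.inter_subset_inter_left hLC)]
    exact ⟨e, Finset.mem_inter.2 ⟨he, heC⟩, fun h => heL (Finset.mem_inter.1 h).2⟩
  · by_contra hne
    obtain ⟨b, hbe, hbt, B₀, hB₀, hlt₀⟩ := exists_weight_of_ne hA hL heL hfL hne
    let β : Finset α → ℝ := fun B => b (indVec B) - b (indVec A)
    let δ : Finset α → ℝ := fun B => ((A ∩ L).card : ℝ) - (B ∩ L).card
    have hδ : ∀ B : Finset α, M.IsBase (B : Set α) → 0 ≤ δ B := fun B hB =>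
      sub_nonneg.2 (by exact_mod_cast hL B hB)
    -- Ratio test: `t` is the largest multiple of `b` that can be added to the indicator of `L` with
    -- `A` still of maximum weight. At this value `B₁`, not tight for `L`, also attains the maximum.
    obtain ⟨B₁, hB₁m, hmin⟩ := (M.baseFinset.filter fun B => 0 < β B).exists_min_image
      (fun B => δ B / β B) ⟨B₀, Finset.mem_filter.2 ⟨mem_baseFinset.2 hB₀, sub_pos.2 hlt₀⟩⟩
    obtain ⟨hB₁, hβ₁⟩ := Finset.mem_filter.1 hB₁m
    rw [mem_baseFinset] at hB₁
    set t := δ B₁ / β B₁ with ht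
    have ht0 : 0 ≤ t := div_nonneg (hδ _ hB₁) hβ₁.le
    have hle : ∀ B : Finset α, M.IsBase (B : Set α) → t * β B ≤ δ B := by
      intro B hB
      rcases le_or_gt (β B) 0 with h0 | h0
      · exact (mul_nonpos_of_nonneg_of_nonpos ht0 h0).trans (hδ B hB)
      · exact (le_div_iff₀ h0).1 (hmin B (Finset.mem_filter.2 ⟨mem_baseFinset.2 hB, h0⟩))
    have heq : t * β B₁ = δ B₁ := div_mul_cancel₀ _ hβ₁.ne'
    let c : α → ℝ := fun i => (if i ∈ L then 1 else 0) + t * b (Pi.single i 1)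
    have hc : ∀ B : Finset α, ∑ i ∈ B, c i = (B ∩ L).card + t * b (indVec B) := by
      intro B
      simp only [c, Finset.sum_add_distrib, ← Finset.mul_sum, indVec_eq_sum, map_sum]
      simp
    have hcmax : ∀ B : Finset α, M.IsBase (B : Set α) → ∑ i ∈ B, c i ≤ ∑ i ∈ A, c i := by
      intro B hB
      have := hle B hB
      simp only [β, δ] at this
      rw [hc, hc]; linarith
    have hsame : ∀ B : Finset α, M.IsBase (B : Set α) → t * β B = δ B →
        (B ∩ (M.exchClass x).filter fun g => c e < c g).card =
        (A ∩ (M.exchClass x).filter fun g => c e < c g).card := by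
      intro B hB hBe
      have hs : ∑ i ∈ B, c i = ∑ i ∈ A, c i := by
        simp only [β, δ] at hBe
        rw [hc, hc]; linarith
      exact (hA.card_inter_filter_le_of_max c hcmax _ hB).antisymm
        (hB.card_inter_filter_le_of_max c (fun B' hB' => hs ▸ hcmax B' hB') _ hA)
    have hcef : c e < c f := by simp [c, heL, hfL, hbe]
    -- By the greedy property a threshold set of the weight `c` is again tight at every base of
    -- maximum weight. The threshold `c e` separates `f` from `e`, because `b` agrees on them and
    -- only `f` lies in `L`. The new face has all the old vertices and `B₁`, against the choice of
    -- `L`.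
    have hL' : (M.exchClass x).filter (fun g => c e < c g) ∈ cand :=
      Finset.mem_filter.2 ⟨Finset.mem_powerset.2 (Finset.filter_subset _ _),
        fun B hB => hA.card_inter_filter_le_of_max c hcmax _ hB, by simp, by simp [hfC, hcef]⟩
    refine absurd (hmax _ hL') (not_le.2 (Finset.card_lt_card ?_))
    rw [Finset.ssubset_iff_of_subset]
    · refine ⟨B₁, Finset.mem_filter.2 ⟨mem_baseFinset.2 hB₁, hsame B₁ hB₁ heq⟩, ?_⟩
      intro h
      have := hbt B₁ hB₁ (Finset.mem_filter.1 h).2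
      simp only [β] at hβ₁
      linarith
    · intro B hB
      obtain ⟨hB, tB⟩ := Finset.mem_filter.1 hB
      have hB' := mem_baseFinset.1 hB
      refine Finset.mem_filter.2 ⟨hB, hsame B hB' ?_⟩
      simp [β, δ, hbt B hB' tB, tB]

end Matroid

/-! ### Two auxiliary facts on set sizes and planar convex sets -/

/-- Take `Y` comparable with every member of the chain `L₁ ∩ L₂ ⊆ L₁ ⊆ L₁ ∪ L₂ ⊆ C`; the four cases
say where in the chain the size `k` falls. -/
theorem Finset.exists_card_inter_lt {α : Type*} [DecidableEq α] {C L₁ L₂ : Finset α} {k r₁ r₂ : ℕ}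
    (h₁ : L₁ ⊆ C) (h₂ : L₂ ⊆ C) (hk : k ≤ C.card) (hr₁ : r₁ < L₁.card) (hr₂ : r₂ < L₂.card)
    (hk₁ : r₁ < k) (hk₂ : r₂ < k) (h : r₁ + r₂ < (L₁ ∩ L₂).card + k) :
    ∃ Y ⊆ C, Y.card = k ∧ r₁ < (Y ∩ L₁).card ∧ r₁ + r₂ < (Y ∩ L₁).card + (Y ∩ L₂).card := by
  rcases le_total k (L₁ ∩ L₂).card with c1 | c1
  · obtain ⟨Y, hY, hc⟩ := Finset.exists_subset_card_eq c1
    have s1 : Y ⊆ L₁ := hY.trans Finset.inter_subset_left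
    have s2 : Y ⊆ L₂ := hY.trans Finset.inter_subset_right
    refine ⟨Y, s1.trans h₁, hc, ?_⟩
    rw [Finset.inter_eq_left.2 s1, Finset.inter_eq_left.2 s2]
    omega
  rcases le_total k L₁.card with c2 | c2
  · obtain ⟨Y, hY1, hY2, hc⟩ := Finset.exists_subsuperset_card_eq Finset.inter_subset_left c1 c2
    refine ⟨Y, hY2.trans h₁, hc, ?_⟩
    have : (L₁ ∩ L₂).card ≤ (Y ∩ L₂).card :=
      Finset.card_le_card (Finset.subset_inter hY1 Finset.inter_subset_right)
    rw [Finset.inter_eq_left.2 hY2]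
    omega
  rcases le_total k (L₁ ∪ L₂).card with c3 | c3
  · obtain ⟨Y, hY1, hY2, hc⟩ := Finset.exists_subsuperset_card_eq Finset.subset_union_left c2 c3
    refine ⟨Y, hY2.trans (Finset.union_subset h₁ h₂), hc, ?_⟩
    have e := Finset.card_union_add_card_inter (Y ∩ L₁) (Y ∩ L₂)
    have e1 : Y ∩ L₁ ∪ Y ∩ L₂ = Y := by
      rw [← Finset.inter_union_distrib_left]; exact Finset.inter_eq_left.2 hY2
    have e2 : (Y ∩ L₁) ∩ (Y ∩ L₂) = L₁ ∩ L₂ := by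
      rw [← Finset.inter_inter_distrib_left]
      exact Finset.inter_eq_right.2 (Finset.inter_subset_left.trans hY1)
    rw [e1, e2] at e
    rw [Finset.inter_eq_right.2 hY1] at e ⊢
    omega
  · obtain ⟨Y, hY1, hY2, hc⟩ :=
      Finset.exists_subsuperset_card_eq (Finset.union_subset h₁ h₂) c3 hk
    refine ⟨Y, hY2, hc, ?_⟩
    rw [Finset.inter_eq_right.2 (Finset.subset_union_left.trans hY1),
      Finset.inter_eq_right.2 (Finset.subset_union_right.trans hY1)]
    omega

/-- A planar convex set meets the open ray through `c` if it contains points on both sides. -/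
theorem Convex.exists_smul_mem {K : Set (ℝ × ℝ)} (hK : Convex ℝ K) {p q p' q' a d c₁ c₂ : ℝ}
    (h : (p, q) ∈ K) (h' : (p', q') ∈ K) (ha : ((0 : ℝ), -a) ∈ K) (hd : (-d, (0 : ℝ)) ∈ K)
    (hp : 0 < p) (hpq : 0 < p + q) (hq' : 0 < q') (hpq' : 0 < p' + q') (ha0 : 0 < a) (hd0 : 0 < d)
    (hc₁ : 0 < c₁) (hc₂ : 0 < c₂) : ∃ s : ℝ, 0 < s ∧ (s * c₁, s * c₂) ∈ K := by
  have comb : ∀ {x y x' y' s t : ℝ}, (x, y) ∈ K → (x', y') ∈ K → 0 ≤ s → 0 ≤ t → 0 < s + t →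
      ((s * x + t * x') / (s + t), (s * y + t * y') / (s + t)) ∈ K := by
    intro x y x' y' s t hx hx' hs ht hst
    have := hK hx hx' (div_nonneg hs hst.le) (div_nonneg ht hst.le)
      (by rw [← add_div, div_self hst.ne'])
    convert this using 1
    ext <;> simp <;> ring
  -- If neither given point is in the open positive quadrant, the segment between them crosses the
  -- diagonal there; the weights below pick that crossing.
  obtain ⟨P, Q, hPQ, hP, hQ⟩ : ∃ P Q, (P, Q) ∈ K ∧ 0 < P ∧ 0 < Q := by
    rcases lt_or_ge 0 q with hq | hq
    · exact ⟨p, q, h, hp, hq⟩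
    rcases lt_or_ge 0 p' with hp' | hp'
    · exact ⟨p', q', h', hp', hq'⟩
    have hdet : 0 < p * q' - q * p' := by nlinarith
    refine ⟨_, _, comb h h' (s := q' - p') (t := p - q) (by linarith) (by linarith) (by linarith),
      div_pos ?_ (by linarith), div_pos ?_ (by linarith)⟩ <;> nlinarith
  -- Depending on the side of the ray on which `(P, Q)` lies, the segment to `(0, -a)` or to `(-d,
  -- 0)` crosses it.
  rcases le_total (c₂ * P) (c₁ * Q) with hle | hle
  · have h0 : 0 ≤ c₁ * Q - c₂ * P := by linarith
    have hpos : 0 < c₁ * a + (c₁ * Q - c₂ * P) := by positivity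
    refine ⟨P * a / (c₁ * a + (c₁ * Q - c₂ * P)), by positivity, ?_⟩
    convert comb hPQ ha (s := c₁ * a) (by positivity) h0 hpos using 2 <;> field_simp <;> ring
  · have h0 : 0 ≤ c₂ * P - c₁ * Q := by linarith
    have hpos : 0 < c₂ * d + (c₂ * P - c₁ * Q) := by positivity
    refine ⟨Q * d / (c₂ * d + (c₂ * P - c₁ * Q)), by positivity, ?_⟩
    convert comb hPQ hd (s := c₂ * d) (by positivity) h0 hpos using 2 <;> field_simp <;> ring

/-! ### Relative interior of the ambient polytope and the intersection bound -/

namespace Matroid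

variable {α : Type*}

theorem eq_of_mem_affineSpan {M : Matroid α} (ℓ : (α → ℝ) →ₗ[ℝ] ℝ) {c : ℝ}
    (h : ∀ v ∈ M.baseVecs, ℓ v = c) {y : α → ℝ} (hy : y ∈ affineSpan ℝ M.baseVecs) : ℓ y = c := by
  obtain ⟨B, hB⟩ := M.exists_isBase
  have hv : B.indicator (1 : α → ℝ) ∈ M.baseVecs := ⟨B, hB, rfl⟩
  have hd := AffineSubspace.vsub_mem_direction hy (subset_affineSpan ℝ _ hv)
  have hle : vectorSpan ℝ M.baseVecs ≤ LinearMap.ker ℓ := by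
    rw [vectorSpan_def, Submodule.span_le]
    rintro _ ⟨p, hp, q, hq, rfl⟩
    simp [h p hp, h q hq]
  rw [direction_affineSpan] at hd
  have := hle hd
  rw [LinearMap.mem_ker, vsub_eq_sub, map_sub, h _ hv] at this
  linarith

theorem card_baseFinset_pos {M : Matroid α} [M.Finite] : 0 < M.baseFinset.card := by
  obtain ⟨B', hB'⟩ := M.exists_isBase
  obtain ⟨A, rfl⟩ := exists_finset_of_isBase hB'
  exact Finset.card_pos.2 ⟨A, mem_baseFinset.2 hB'⟩

/-- The points of the affine span of the base polytope with coordinates in the unit interval. -/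
def unitSlice (M : Matroid α) : Set (α → ℝ) :=
  {y | y ∈ affineSpan ℝ M.baseVecs ∧ ∀ i, 0 ≤ y i ∧ y i ≤ 1}

theorem unitSlice_combo {M : Matroid α} {y z : α → ℝ} (hy : y ∈ M.unitSlice)
    (hz : z ∈ M.unitSlice) {s t : ℝ}
    (hs : 0 ≤ s) (ht : 0 ≤ t) (hst : s + t = 1) : s • y + t • z ∈ M.unitSlice := by
  refine ⟨(affineSpan ℝ M.baseVecs).convex hy.1 hz.1 hs ht hst, fun i => ?_⟩
  have h1 := hy.2 i
  have h2 := hz.2 i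
  simp only [Pi.add_apply, Pi.smul_apply, smul_eq_mul]
  constructor <;> nlinarith

theorem indVec_mem_unitSlice_of_isBase [DecidableEq α] {M : Matroid α} {A : Finset α} (hA : M.IsBase (A : Set α)) :
    indVec A ∈ M.unitSlice := by
  refine ⟨subset_affineSpan ℝ _ (indVec_mem_baseVecs hA), fun i => ?_⟩
  rw [indVec_apply]
  split_ifs <;> simp

/-- The average of the vertices of the base polytope. -/
noncomputable def barycenter (M : Matroid α) [M.Finite] : α → ℝ :=
  (M.baseFinset.card : ℝ)⁻¹ • ∑ B ∈ M.baseFinset, indVec B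

theorem barycenter_mem {M : Matroid α} [M.Finite] : M.barycenter ∈ affineSpan ℝ M.baseVecs := by
  have hpos : (0 : ℝ) < M.baseFinset.card := by exact_mod_cast card_baseFinset_pos
  refine convexHull_subset_affineSpan _ ?_
  rw [barycenter, Finset.smul_sum]
  refine (convex_convexHull ℝ _).sum_mem (fun _ _ => by positivity) ?_ fun B hB =>
    subset_convexHull ℝ _ (indVec_mem_baseVecs (mem_baseFinset.1 hB))
  rw [Finset.sum_const, nsmul_eq_mul, mul_inv_cancel₀ hpos.ne']

theorem lt_apply_barycenter {M : Matroid α} [M.Finite] (ℓ : (α → ℝ) →ₗ[ℝ] ℝ) {c : ℝ}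
    (h : ∀ B : Finset α, M.IsBase (B : Set α) → c ≤ ℓ (indVec B)) {B : Finset α}
    (hB : M.IsBase (B : Set α)) (hlt : c < ℓ (indVec B)) : c < ℓ M.barycenter := by
  have hpos : (0 : ℝ) < M.baseFinset.card := by exact_mod_cast card_baseFinset_pos
  rw [barycenter, map_smul, map_sum, smul_eq_mul, inv_mul_eq_div, lt_div_iff₀ hpos, mul_comm,
    ← nsmul_eq_mul, ← Finset.sum_const]
  exact Finset.sum_lt_sum (fun B hB => h B (mem_baseFinset.1 hB)) ⟨B, mem_baseFinset.2 hB, hlt⟩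

variable [DecidableEq α] {M : Matroid α} [M.Finite]

/-- A coordinate on which all bases agree is constant on the affine span, so only the remaining
coordinates need to be bounded. -/
theorem mem_ambientPolytope {y : α → ℝ} (hy : y ∈ affineSpan ℝ M.baseVecs)
    (h : ∀ i ∈ M.E, (∃ B : Finset α, M.IsBase (B : Set α) ∧ i ∈ B) →
      (∃ B : Finset α, M.IsBase (B : Set α) ∧ i ∉ B) → 0 < y i ∧ y i < 1) :
    y ∈ ambientPolytope M := by
  have proj : ∀ i (c : ℝ), (∀ B : Finset α, M.IsBase (B : Set α) → indVec B i = c) → y i = c := by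
    intro i c hc
    refine eq_of_mem_affineSpan (LinearMap.proj i) (fun v hv => ?_) hy
    obtain ⟨B, hB, rfl⟩ := mem_baseVecs.1 hv
    exact hc B hB
  have hout : ∀ i ∉ M.E, y i = 0 := by
    refine fun i hi => proj i 0 fun B hB => ?_
    rw [indVec_apply, if_neg fun h : i ∈ B => hi (hB.subset_ground h)]
  obtain ⟨B', hB'⟩ := M.exists_isBase
  obtain ⟨A, rfl⟩ := exists_finset_of_isBase hB'
  refine ⟨⟨fun i => ?_, hout, ?_⟩, by rw [affineSpan_basePolytope]; exact hy⟩
  · by_cases hi : i ∈ M.E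
    · by_cases h1 : ∃ B : Finset α, M.IsBase (B : Set α) ∧ i ∈ B
      · by_cases h2 : ∃ B : Finset α, M.IsBase (B : Set α) ∧ i ∉ B
        · exact ⟨(h i hi h1 h2).1.le, (h i hi h1 h2).2.le⟩
        · push Not at h2
          rw [proj i 1 fun B hB => by rw [indVec_apply, if_pos (h2 B hB)]]
          simp
      · push Not at h1
        rw [proj i 0 fun B hB => by rw [indVec_apply, if_neg (h1 B hB)]]
        simp
    · simp [hout i hi]
  · rw [finsum_mem_eq_finite_toFinset_sum _ M.ground_finite, ← coordSum_apply,
      ← hB'.encard_eq_eRank, Set.encard_coe_eq_coe_finsetCard]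
    refine eq_of_mem_affineSpan (coordSum _).toLinearMap (fun v hv => ?_) hy
    obtain ⟨B, hB, rfl⟩ := mem_baseVecs.1 hv
    have : B ∩ M.ground_finite.toFinset = B :=
      Finset.inter_eq_left.2 fun i hi => by simpa using hB.subset_ground hi
    simp [coordSum_indVec, this, hB.card_eq hB']

/-- The finitely many strict inequalities define an open set whose trace on the affine span stays
inside the polytope. -/
theorem mem_intrinsicInterior_ambientPolytope {y : α → ℝ} (hy : y ∈ affineSpan ℝ M.baseVecs)
    (h : ∀ i ∈ M.E, (∃ B : Finset α, M.IsBase (B : Set α) ∧ i ∈ B) →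
      (∃ B : Finset α, M.IsBase (B : Set α) ∧ i ∉ B) → 0 < y i ∧ y i < 1) :
    y ∈ intrinsicInterior ℝ (ambientPolytope M) := by
  let U : Set (α → ℝ) := ⋂ i ∈ M.E, {z | (∃ B : Finset α, M.IsBase (B : Set α) ∧ i ∈ B) →
      (∃ B : Finset α, M.IsBase (B : Set α) ∧ i ∉ B) → 0 < z i ∧ z i < 1}
  have hU : IsOpen U := by
    refine M.ground_finite.isOpen_biInter fun i _ => ?_
    by_cases h1 : ∃ B : Finset α, M.IsBase (B : Set α) ∧ i ∈ B
    · by_cases h2 : ∃ B : Finset α, M.IsBase (B : Set α) ∧ i ∉ B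
      · simp only [h1, h2, forall_true_left]
        exact (isOpen_lt continuous_const (continuous_apply i)).inter
          (isOpen_lt (continuous_apply i) continuous_const)
      · simp [h2]
    · simp [h1]
  have hamb : y ∈ ambientPolytope M := mem_ambientPolytope hy h
  have hle : affineSpan ℝ (ambientPolytope M) ≤ affineSpan ℝ M.baseVecs := by
    rw [affineSpan_le, ← affineSpan_basePolytope]
    exact Set.inter_subset_right
  rw [mem_intrinsicInterior]
  refine ⟨⟨y, subset_affineSpan ℝ _ hamb⟩, mem_interior.2 ⟨(↑) ⁻¹' U, ?_,
    hU.preimage continuous_subtype_val, ?_⟩, rfl⟩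
  · rintro ⟨z, hz⟩ hzU
    have hzU' : z ∈ U := hzU
    simp only [U, Set.mem_iInter] at hzU'
    exact mem_ambientPolytope (hle hz) hzU'
  · change y ∈ U
    simp only [U, Set.mem_iInter]
    exact h

/-- The face of the base polytope on which the coordinate sum over `L` is largest. -/
def faceOf (M : Matroid α) [M.Finite] (L : Finset α) : Set (α → ℝ) :=
  {y ∈ basePolytope M | coordSum L y = M.capacity L}

theorem tightVecs_subset_faceOf (L : Finset α) : M.tightVecs L ⊆ M.faceOf L := by
  rintro _ ⟨B, hB, tB, rfl⟩
  exact ⟨subset_convexHull ℝ _ (indVec_mem_baseVecs hB), by rw [coordSum_indVec, tB]⟩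

theorem coordSum_le_capacity (L : Finset α) {y : α → ℝ} (hy : y ∈ basePolytope M) :
    coordSum L y ≤ M.capacity L := by
  have : basePolytope M ⊆ {y | coordSum L y ≤ M.capacity L} := by
    refine convexHull_min ?_ (convex_halfSpace_le (coordSum L).toLinearMap.isLinear _)
    intro v hv
    obtain ⟨B, hB, rfl⟩ := mem_baseVecs.1 hv
    simpa [coordSum_indVec] using hB.card_inter_le_capacity L
  exact this hy

theorem IsFacetSet.vectorSpan_faceOf {x : α} {L : Finset α} (hL : M.IsFacetSet x L) :
    vectorSpan ℝ (M.faceOf L) =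
      vectorSpan ℝ M.baseVecs ⊓ LinearMap.ker (coordSum L).toLinearMap := by
  refine le_antisymm (le_inf ?_ ?_) ?_
  · rw [← vectorSpan_basePolytope]
    exact vectorSpan_mono ℝ (fun y hy => hy.1)
  · rw [vectorSpan_def, Submodule.span_le]
    rintro _ ⟨p, hp, q, hq, rfl⟩
    simp [hp.2, hq.2]
  · rw [← hL.vectorSpan_eq]
    exact vectorSpan_mono ℝ (tightVecs_subset_faceOf L)

/-- The base `B` off the face makes the coordinate sum a nonzero functional on the direction space,
so its kernel there has codimension one. -/
theorem IsFacetSet.isFacet {x : α} {L B : Finset α} (hL : M.IsFacetSet x L)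
    (hB : M.IsBase (B : Set α)) (hlt : (B ∩ L).card < M.capacity L) :
    IsFacet (basePolytope M) (M.faceOf L) := by
  obtain ⟨A, hA, tA, -⟩ := hL.exists_lt
  have hA' : indVec A ∈ M.faceOf L := tightVecs_subset_faceOf L ⟨A, hA, tA, rfl⟩
  refine ⟨⟨_, hA'⟩, fun _ => ⟨coordSum L, ?_⟩, ?_⟩
  · ext y
    constructor
    · rintro ⟨hy, h⟩
      exact ⟨hy, fun z hz => (coordSum_le_capacity L hz).trans_eq h.symm⟩
    · rintro ⟨hy, h⟩
      exact ⟨hy, (coordSum_le_capacity L hy).antisymm (hA'.2 ▸ h _ hA'.1)⟩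
  · rw [hL.vectorSpan_faceOf, vectorSpan_basePolytope]
    set V := vectorSpan ℝ M.baseVecs
    have : FiniteDimensional ℝ V := finiteDimensional_vectorSpan_of_finite ℝ M.baseVecs_finite
    let g : Module.Dual ℝ V := (coordSum L).toLinearMap.domRestrict V
    have hg : g ≠ 0 := by
      intro h0
      have := LinearMap.congr_fun h0 ⟨_, indVec_sub_mem hA hB⟩
      simp only [g, LinearMap.domRestrict_apply, ContinuousLinearMap.coe_coe, map_sub,
        coordSum_indVec, tA, LinearMap.zero_apply, sub_eq_zero, Nat.cast_inj] at this
      omega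
    rw [← Module.Dual.finrank_ker_add_one_of_ne_zero hg]
    congr 1
    have : V ⊓ LinearMap.ker (coordSum L).toLinearMap = (LinearMap.ker g).map V.subtype := by
      ext v
      simp [g, and_comm]
    rw [this, Submodule.finrank_map_subtype_eq]

theorem IsFacetSet.mem_affineSpan {x : α} {L : Finset α} (hL : M.IsFacetSet x L) {y : α → ℝ}
    (hy : y ∈ affineSpan ℝ M.baseVecs) (h : coordSum L y = M.capacity L) :
    y ∈ affineSpan ℝ (M.faceOf L) := by
  obtain ⟨A, hA, tA, -⟩ := hL.exists_lt
  have hA' : indVec A ∈ M.faceOf L := tightVecs_subset_faceOf L ⟨A, hA, tA, rfl⟩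
  rw [← AffineSubspace.vsub_right_mem_direction_iff_mem (subset_affineSpan ℝ _ hA'),
    direction_affineSpan, hL.vectorSpan_faceOf]
  refine ⟨?_, by simp [h, coordSum_indVec, tA]⟩
  rw [← direction_affineSpan]
  exact AffineSubspace.vsub_mem_direction hy (subset_affineSpan ℝ _ (indVec_mem_baseVecs hA))

/-- Otherwise one face contains the other, and the direction space of the first lies in the kernel
of the second coordinate sum. Elements of the class on the same side of `L₁` are then on the same
side of `L₂`, so `L₂` is `L₁` or its complement in the class. In the latter case `L₁ ∩ L₂` is empty
and `L₁ ∪ L₂` covers the class, which contradicts `hlt`. -/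
theorem IsFacetSet.exists_tight_not_tight {x : α} {L₁ L₂ : Finset α} (h₁ : M.IsFacetSet x L₁)
    (h₂ : M.IsFacetSet x L₂) (hne : L₁ ≠ L₂) {A : Finset α} (hA : M.IsBase (A : Set α))
    (hlt : M.capacity L₁ + M.capacity L₂ < (L₁ ∩ L₂).card + (A ∩ M.exchClass x).card) :
    ∃ B : Finset α, M.IsBase (B : Set α) ∧ (B ∩ L₁).card = M.capacity L₁ ∧
      (B ∩ L₂).card < M.capacity L₂ := by
  by_contra! hcon
  have hsub : M.tightVecs L₁ ⊆ M.tightVecs L₂ := by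
    rintro _ ⟨B, hB, tB, rfl⟩
    exact ⟨B, hB, (hB.card_inter_le_capacity L₂).antisymm (hcon B hB tB), rfl⟩
  have hW := vectorSpan_mono ℝ hsub
  rw [h₁.vectorSpan_eq, h₂.vectorSpan_eq] at hW
  have same : ∀ a ∈ M.exchClass x, ∀ b ∈ M.exchClass x, (a ∈ L₁ ↔ b ∈ L₁) →
      (a ∈ L₂ ↔ b ∈ L₂) := by
    intro a ha b hb hab
    have hm : (Pi.single b 1 - Pi.single a 1 : α → ℝ) ∈
        vectorSpan ℝ M.baseVecs ⊓ LinearMap.ker (coordSum L₁).toLinearMap :=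
      ⟨single_sub_single_mem ha hb, by simp [coordSum_single, hab]⟩
    have := (hW hm).2
    by_cases a ∈ L₂ <;> by_cases b ∈ L₂ <;> simp_all [coordSum_single]
  have ex : ∀ {L}, M.IsFacetSet x L → (∃ a ∈ M.exchClass x, a ∈ L) ∧
      ∃ a ∈ M.exchClass x, a ∉ L := by
    intro L hL
    constructor
    · obtain ⟨a, ha⟩ := Finset.card_pos.1 (Nat.zero_lt_of_lt hL.lt_card)
      exact ⟨a, hL.subset ha, ha⟩
    · obtain ⟨A, -, -, hlt⟩ := hL.exists_lt
      by_contra! hall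
      exact absurd hlt (not_lt.2 (Finset.card_le_card
        (Finset.inter_subset_inter_left fun a ha => hall a ha)))
  obtain ⟨⟨a, haC, ha⟩, b, hbC, hb⟩ := ex h₁
  obtain ⟨⟨a', haC', ha'⟩, b', hbC', hb'⟩ := ex h₂
  have hdis : ∀ y ∈ M.exchClass x, y ∈ L₁ ↔ y ∉ L₂ := by
    by_contra hno
    refine hne ?_
    have in1 : ∀ y ∈ M.exchClass x, y ∈ L₁ → (y ∈ L₂ ↔ a ∈ L₂) := fun y hy h =>
      same y hy a haC (by simp [h, ha])
    have in2 : ∀ y ∈ M.exchClass x, y ∉ L₁ → (y ∈ L₂ ↔ b ∈ L₂) := fun y hy h =>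
      same y hy b hbC (by simp [h, hb])
    ext y
    by_cases hy : y ∈ M.exchClass x
    · have := in1 y hy
      have := in2 y hy
      have := in1 a' haC'
      have := in2 a' haC'
      have := in1 b' hbC'
      have := in2 b' hbC'
      by_cases hab : a ∈ L₂ <;> by_cases hbb : b ∈ L₂
      · grind
      · grind
      · exfalso
        refine hno fun z hz => ?_
        have := in1 z hz
        have := in2 z hz
        grind
      · grind
    · exact ⟨fun h => absurd (h₁.subset h) hy, fun h => absurd (h₂.subset h) hy⟩
  have h0 : L₁ ∩ L₂ = ∅ := by
    ext y
    simp only [Finset.mem_inter, Finset.notMem_empty, iff_false, not_and]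
    exact fun h => (hdis y (h₁.subset h)).1 h
  have hcov : A ∩ M.exchClass x ⊆ (A ∩ L₁) ∪ (A ∩ L₂) := by
    intro y hy
    obtain ⟨hyA, hyC⟩ := Finset.mem_inter.1 hy
    have := hdis y hyC
    simp only [Finset.mem_union, Finset.mem_inter]
    tauto
  have c1 := (Finset.card_le_card hcov).trans (Finset.card_union_le _ _)
  have c2 := hA.card_inter_le_capacity L₁
  have c3 := hA.card_inter_le_capacity L₂
  rw [h0, Finset.card_empty] at hlt
  omega

theorem coordSum_barycenter_lt {L B : Finset α} (hB : M.IsBase (B : Set α))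
    (hlt : (B ∩ L).card < M.capacity L) : coordSum L M.barycenter < M.capacity L := by
  have := lt_apply_barycenter (M := M) (-(coordSum L).toLinearMap) (c := -(M.capacity L : ℝ))
    (fun B hB => by simpa [coordSum_indVec] using hB.card_inter_le_capacity L) hB
    (by simpa [coordSum_indVec] using hlt)
  simpa using this

theorem barycenter_apply_mem {i : α} (h1 : ∃ B : Finset α, M.IsBase (B : Set α) ∧ i ∈ B)
    (h2 : ∃ B : Finset α, M.IsBase (B : Set α) ∧ i ∉ B) :
    0 < M.barycenter i ∧ M.barycenter i < 1 := by
  obtain ⟨B, hB, hi⟩ := h1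
  obtain ⟨B', hB', hi'⟩ := h2
  constructor
  · exact lt_apply_barycenter (M := M) (LinearMap.proj i) (c := 0)
      (fun B _ => by simp only [LinearMap.proj_apply, indVec_apply]; split_ifs <;> simp) hB
      (by simp [indVec_apply, hi])
  · have := lt_apply_barycenter (M := M) (-LinearMap.proj i) (c := -1)
      (fun B _ => by
        simp only [LinearMap.neg_apply, LinearMap.proj_apply, indVec_apply]; split_ifs <;> simp) hB'
      (by simp [indVec_apply, hi'])
    simpa using this

/-- The modified set need not be a base: these are the points of the slice that may violate the
facet inequalities. -/
theorem indVec_mem_unitSlice {x : α} {A Y : Finset α} (hA : M.IsBase (A : Set α))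
    (hY : Y ⊆ M.exchClass x) (hc : Y.card = (A ∩ M.exchClass x).card) :
    indVec (Y ∪ A \ M.exchClass x) ∈ M.unitSlice := by
  constructor
  · rw [← AffineSubspace.vsub_right_mem_direction_iff_mem
      (subset_affineSpan ℝ _ (indVec_mem_baseVecs hA)), direction_affineSpan]
    have := indVec_sub_mem_of_subset hY Finset.inter_subset_right hc
    convert this using 1
    ext i
    simp only [vsub_eq_sub, Pi.sub_apply, indVec_apply, Finset.mem_union, Finset.mem_sdiff,
      Finset.mem_inter]
    have := @hY i
    by_cases i ∈ Y <;> by_cases i ∈ A <;> by_cases i ∈ M.exchClass x <;> simp_all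
  · intro i
    rw [indVec_apply]
    split_ifs <;> simp

/-- The intersection bound for the split flacets within one component of a split matroid. -/
theorem IsFacetSet.card_inter_add_le (hM : IsSplit M) {x : α} {L₁ L₂ : Finset α}
    (h₁ : M.IsFacetSet x L₁) (h₂ : M.IsFacetSet x L₂) (hne : L₁ ≠ L₂) {A : Finset α}
    (hA : M.IsBase (A : Set α)) :
    (L₁ ∩ L₂).card + (A ∩ M.exchClass x).card ≤ M.capacity L₁ + M.capacity L₂ := by
  by_contra! hlt
  have hlt' : M.capacity L₂ + M.capacity L₁ < (L₂ ∩ L₁).card + (A ∩ M.exchClass x).card := by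
    rw [Finset.inter_comm, add_comm (M.capacity L₂)]; exact hlt
  obtain ⟨B₁, hB₁, t₁₁, t₁₂⟩ := h₁.exists_tight_not_tight h₂ hne hA hlt
  obtain ⟨B₂, hB₂, t₂₂, t₂₁⟩ := h₂.exists_tight_not_tight h₁ hne.symm hA hlt'
  have hk : ∀ {L}, M.IsFacetSet x L → M.capacity L < (A ∩ M.exchClass x).card := by
    intro L hL
    obtain ⟨B, hB, tB, hlt⟩ := hL.exists_lt
    rw [card_inter_exchClass x hA hB]; omega
  have hkC : (A ∩ M.exchClass x).card ≤ (M.exchClass x).card :=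
    Finset.card_le_card Finset.inter_subset_right
  obtain ⟨Y₁, hY₁, c₁, p₁, q₁⟩ := Finset.exists_card_inter_lt h₁.subset h₂.subset hkC h₁.lt_card
    h₂.lt_card (hk h₁) (hk h₂) hlt
  obtain ⟨Y₂, hY₂, c₂, p₂, q₂⟩ := Finset.exists_card_inter_lt h₂.subset h₁.subset hkC h₂.lt_card
    h₁.lt_card (hk h₂) (hk h₁) hlt'
  have hcard : ∀ {Y L : Finset α}, M.IsFacetSet x L →
      coordSum L (indVec (Y ∪ A \ M.exchClass x)) = (Y ∩ L).card := by
    intro Y L hL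
    rw [coordSum_indVec]
    congr 2
    ext i
    have := @hL.subset i
    simp only [Finset.mem_inter, Finset.mem_union, Finset.mem_sdiff]
    tauto
  -- The slice is projected to the plane of the two excesses over capacity. The barycenter goes to a
  -- point with both coordinates negative; `Y₁`, `Y₂` and `B₁`, `B₂` supply the points showing that
  -- `K` meets the opposite open ray.
  let K : Set (ℝ × ℝ) := {w | ∃ z ∈ M.unitSlice, coordSum L₁ z = M.capacity L₁ + w.1 ∧
    coordSum L₂ z = M.capacity L₂ + w.2}
  have hK : Convex ℝ K := by
    rintro w ⟨z, hz, e1, e2⟩ w' ⟨z', hz', e1', e2'⟩ s t hs ht hst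
    refine ⟨s • z + t • z', unitSlice_combo hz hz' hs ht hst, ?_, ?_⟩
    · simp only [map_add, map_smul, e1, e1', smul_eq_mul, Prod.fst_add, Prod.smul_fst]
      linear_combination (M.capacity L₁ : ℝ) * hst
    · simp only [map_add, map_smul, e2, e2', smul_eq_mul, Prod.snd_add, Prod.smul_snd]
      linear_combination (M.capacity L₂ : ℝ) * hst
  have hmem : ∀ z ∈ M.unitSlice, (coordSum L₁ z - M.capacity L₁, coordSum L₂ z - M.capacity L₂) ∈ K :=
    fun z hz => ⟨z, hz, by simp, by simp⟩
  have m1 := hmem _ (indVec_mem_unitSlice hA hY₁ c₁)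
  have m2 := hmem _ (indVec_mem_unitSlice hA hY₂ c₂)
  have m3 := hmem _ (indVec_mem_unitSlice_of_isBase hB₁)
  have m4 := hmem _ (indVec_mem_unitSlice_of_isBase hB₂)
  rw [hcard h₁, hcard h₂] at m1 m2
  rw [coordSum_indVec, coordSum_indVec] at m3 m4
  rw [t₁₁, sub_self, ← neg_sub] at m3
  rw [t₂₂, sub_self, ← neg_sub (M.capacity L₁ : ℝ)] at m4
  have b₁ := coordSum_barycenter_lt hB₂ t₂₁
  have b₂ := coordSum_barycenter_lt hB₁ t₁₂
  have p₁' : (M.capacity L₁ : ℝ) < (Y₁ ∩ L₁).card := by exact_mod_cast p₁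
  have p₂' : (M.capacity L₂ : ℝ) < (Y₂ ∩ L₂).card := by exact_mod_cast p₂
  have q₁' : (M.capacity L₁ : ℝ) + M.capacity L₂ < (Y₁ ∩ L₁).card + (Y₁ ∩ L₂).card := by
    exact_mod_cast q₁
  have q₂' : (M.capacity L₂ : ℝ) + M.capacity L₁ < (Y₂ ∩ L₂).card + (Y₂ ∩ L₁).card := by
    exact_mod_cast q₂
  have t₁₂' : ((B₁ ∩ L₂).card : ℝ) < M.capacity L₂ := by exact_mod_cast t₁₂
  have t₂₁' : ((B₂ ∩ L₁).card : ℝ) < M.capacity L₁ := by exact_mod_cast t₂₁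
  obtain ⟨s, hs, z, hz, e1, e2⟩ := hK.exists_smul_mem m1 m2 m3 m4 (by linarith) (by linarith)
    (by linarith) (by linarith) (by linarith) (by linarith) (sub_pos.2 b₁) (sub_pos.2 b₂)
  simp only at e1 e2
  have hs1 : 0 < 1 + s := by linarith
  -- The weights cancel both excesses, so `y` is on both hyperplanes. The barycenter has positive
  -- weight, hence the coordinates that vary among bases are strictly between `0` and `1`.
  set y : α → ℝ := (s / (1 + s)) • M.barycenter + (1 / (1 + s)) • z with hy
  have hsum : s / (1 + s) + 1 / (1 + s) = 1 := by field_simp; ring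
  have hyS : y ∈ affineSpan ℝ M.baseVecs :=
    (affineSpan ℝ M.baseVecs).convex barycenter_mem hz.1 (by positivity) (by positivity) hsum
  have hy1 : coordSum L₁ y = M.capacity L₁ := by
    rw [hy, map_add, map_smul, map_smul, e1, smul_eq_mul, smul_eq_mul]
    field_simp; ring
  have hy2 : coordSum L₂ y = M.capacity L₂ := by
    rw [hy, map_add, map_smul, map_smul, e2, smul_eq_mul, smul_eq_mul]
    field_simp; ring
  have hΦ : M.faceOf L₁ ≠ M.faceOf L₂ := by
    intro h
    have := (h ▸ tightVecs_subset_faceOf L₁ ⟨B₁, hB₁, t₁₁, rfl⟩ : indVec B₁ ∈ M.faceOf L₂).2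
    rw [coordSum_indVec] at this
    linarith
  refine Set.disjoint_left.1 (hM _ _ (h₁.isFacet hB₂ t₂₁) (h₂.isFacet hB₁ t₁₂) hΦ)
    ⟨h₁.mem_affineSpan hyS hy1, h₂.mem_affineSpan hyS hy2⟩
    (mem_intrinsicInterior_ambientPolytope hyS fun i _ i1 i2 => ?_)
  obtain ⟨a1, a2⟩ := barycenter_apply_mem i1 i2
  obtain ⟨z1, z2⟩ := hz.2 i
  have w1 : 0 < s / (1 + s) := by positivity
  have w2 : 0 < 1 / (1 + s) := by positivity
  simp only [hy, Pi.add_apply, Pi.smul_apply, smul_eq_mul]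
  constructor
  · have := mul_pos w1 a1
    have := mul_nonneg w2.le z1
    linarith
  · have := mul_lt_mul_of_pos_left a2 w1
    have := mul_le_mul_of_nonneg_left z2 w2.le
    linarith

end Matroid

/-! ### White's conjecture for pairs of bases -/

theorem Matroid.splitSystem {α : Type*} [DecidableEq α] {M : Matroid α} [M.Finite] (hM : IsSplit M)
    (x : α) {A : Finset α} (hA : M.IsBase (A : Set α)) :
    SplitSystem (fun B : Finset α => M.IsBase (B : Set α)) (M.exchClass x)
      (A ∩ M.exchClass x).card (M.IsFacetSet x) M.capacity where
  card_inter hB := card_inter_exchClass x hB hA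
  subset hL := hL.subset
  le hB _ := hB.card_inter_le_capacity _
  exists_tight hB he heC hfC hf hn := hB.exists_isFacetSet he heC hf hfC hn
  inter_le hL hL' hne := hL.card_inter_add_le hM hL' hne hA

/-- Compatible basis pairs of a split matroid are connected by symmetric exchanges. -/
theorem Matroid.reflTransGen_pairExchange {α : Type*} [DecidableEq α] {M : Matroid α} [M.Finite]
    (hM : IsSplit M) {A A' B B' : Finset α} (hA : M.IsBase (A : Set α))
    (hA' : M.IsBase (A' : Set α)) (hB : M.IsBase (B : Set α)) (hB' : M.IsBase (B' : Set α))
    (hI : A ∩ A' = B ∩ B') (hU : A ∪ A' = B ∪ B') :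
    Relation.ReflTransGen (PairExchange fun S : Finset α => M.IsBase (S : Set α))
      (A, A') (B, B') := by
  induction hn : (A \ B).card using Nat.strong_induction_on generalizing A A' with
  | _ n ih =>
    rcases (A \ B).eq_empty_or_nonempty with h0 | ⟨e, he⟩
    · have hAB : A = B :=
        Finset.eq_of_subset_of_card_le (Finset.sdiff_eq_empty_iff_subset.1 h0) (hB.card_eq hA).le
      subst hAB
      have : A' = B' := by
        ext y
        have h1 := Finset.ext_iff.1 hI y
        have h2 := Finset.ext_iff.1 hU y
        simp only [Finset.mem_inter, Finset.mem_union] at h1 h2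
        tauto
      rw [this]
    -- Each round works in the component of an element still misplaced; different rounds may use
    -- different components.
    · have heC : e ∈ M.exchClass e :=
        mem_exchClass.2 ⟨hA.subset_ground (Finset.mem_sdiff.1 he).1, .refl e⟩
      obtain ⟨q, hq, hlt⟩ := (splitSystem hM e hA).exists_closer (fun h h' => h.card_eq h') hA hA'
        hB hB' hI hU he heC
      obtain ⟨b1, b2, i, u⟩ := PairExchange.reflTransGen_invariant hq hA hA'
      exact hq.trans (ih _ (hn ▸ hlt) b1 b2 (i.trans hI) (u.trans hU) rfl)

theorem SymmExchange.of_pairExchange {α : Type*} [DecidableEq α] {M : Matroid α}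
    {p q : Finset α × Finset α}
    (h : PairExchange (fun S : Finset α => M.IsBase (S : Set α)) p q) :
    SymmExchange M ![(p.1 : Set α), p.2] ![(q.1 : Set α), q.2] := by
  obtain ⟨e, he, f, hf, h1, h2, rfl⟩ := h
  refine ⟨0, 1, by decide, e, by simpa using he, f, by simpa using hf, by simpa using h1,
    by simpa using h2, ?_⟩
  funext i
  fin_cases i <;> simp [Function.update]

theorem Fin.ncard_setOf_mem_two {α : Type*} (X : Fin 2 → Set α) (s : α) [Decidable (s ∈ X 0)]
    [Decidable (s ∈ X 1)] :
    {i | s ∈ X i}.ncard = (if s ∈ X 0 then 1 else 0) + (if s ∈ X 1 then 1 else 0) := by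
  classical
  have : {i | s ∈ X i} = ((Finset.univ.filter fun i => s ∈ X i : Finset (Fin 2)) : Set (Fin 2)) := by
    ext; simp
  rw [this, Set.ncard_coe_finset, Finset.card_filter, Fin.sum_univ_two]
  congr

theorem SymmExchange.ncard_eq {α : Type*} {M : Matroid α} {X X' : Fin 2 → Set α}
    (h : SymmExchange M X X') (s : α) : {i | s ∈ X i}.ncard = {i | s ∈ X' i}.ncard := by
  classical
  obtain ⟨i, j, hij, e, he, f, hf, -, -, rfl⟩ := h
  obtain ⟨rfl, rfl⟩ : i = 0 ∧ j = 1 := by omega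
  rw [Fin.ncard_setOf_mem_two, Fin.ncard_setOf_mem_two]
  simp only [Function.update, Set.mem_sdiff] at *
  by_cases hse : s = e <;> by_cases hsf : s = f <;> simp_all

theorem corollary3p4 {α : Type*} (M : Matroid α) [M.Finite] (hM : IsSplit M)
    (X Y : Fin 2 → Set α) (hX : ∀ i, M.IsBase (X i)) (hY : ∀ i, M.IsBase (Y i)) :
    SeqEquivalent M X Y ↔ SeqCompatible M X Y := by
  classical
  constructor
  · intro h s _
    clear hY
    induction h with
    | refl => rfl
    | tail _ h ih => exact ih.trans (h.ncard_eq s)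
  · intro h
    obtain ⟨A, hA⟩ := Matroid.exists_finset_of_isBase (hX 0)
    obtain ⟨A', hA'⟩ := Matroid.exists_finset_of_isBase (hX 1)
    obtain ⟨B, hB⟩ := Matroid.exists_finset_of_isBase (hY 0)
    obtain ⟨B', hB'⟩ := Matroid.exists_finset_of_isBase (hY 1)
    have hXeq : X = ![(A : Set α), A'] := by funext i; fin_cases i <;> simp [hA, hA']
    have hYeq : Y = ![(B : Set α), B'] := by funext i; fin_cases i <;> simp [hB, hB']
    have bA : M.IsBase (A : Set α) := hA ▸ hX 0
    have bA' : M.IsBase (A' : Set α) := hA' ▸ hX 1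
    have bB : M.IsBase (B : Set α) := hB ▸ hY 0
    have bB' : M.IsBase (B' : Set α) := hB' ▸ hY 1
    have key : ∀ s, (s ∈ A ∧ s ∈ A' ↔ s ∈ B ∧ s ∈ B') ∧ (s ∈ A ∨ s ∈ A' ↔ s ∈ B ∨ s ∈ B') := by
      intro s
      by_cases hs : s ∈ M.E
      · have := h s hs
        rw [Fin.ncard_setOf_mem_two, Fin.ncard_setOf_mem_two] at this
        simp only [← hA, ← hA', ← hB, ← hB', Finset.mem_coe] at this
        split_ifs at this <;> first | omega | tauto
      · have n : ∀ {S : Finset α}, M.IsBase (S : Set α) → s ∉ S :=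
          fun hS h => hs (hS.subset_ground h)
        simp [n bA, n bA', n bB, n bB']
    have hI : A ∩ A' = B ∩ B' := by ext s; simpa using (key s).1
    have hU : A ∪ A' = B ∪ B' := by ext s; simpa using (key s).2
    have hr := Matroid.reflTransGen_pairExchange hM bA bA' bB bB' hI hU
    rw [hXeq, hYeq]
    exact hr.lift (fun p : Finset α × Finset α => ![(p.1 : Set α), p.2])
      fun _ _ hpq => SymmExchange.of_pairExchange hpq
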